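/- **Proposition 2.2.** Let $a\in C^2(\mathbb R)$ and let $M,\rho,\kappa>0$ satisfy $|a'(s)|\le M$, $|a''(s)|\le M$ and $\rho\le a(s)\le\kappa$ for all $s\in\mathbb R$. Let $C_0>0$ be a constant for which the Gagliardo–Nirenberg inequality $$\|u_x\|_{L^4(0,1)}\le C_0\|u\|_{L^\infty(0,1)}^{1/2}\|u_{xx}\|_{L^2(0,1)}^{1/2}+C_0\|u\|_{L^2(0,1)}$$ holds for all $u\in H^2(0,1)$ (such constants exist). Let $T>0$, $Q_T=(0,1)\times(0,T)$, $y_0\in H^1_0(0,1)$, and let $y\in W^{2,1}_2(Q_T)$ (that is, $y,y_x,y_{xx},y_t\in L^2(Q_T)$), identified with its continuous representative on $[0,1]\times[0,T]$, be a solution of $$y_t-(a(y)y_x)_x=0\ \text{ in } Q_T,\qquad y(0,t)=y(1,t)=0\ \text{ for } t\in(0,T),\qquad y(x,0)=y_0(x)\ \text{ for } x\in(0,1).$$ If $$\|y(\cdot,t)\|_{L^\infty(0,1)}\le\frac{\rho}{4MC_0^2}\qquad\text{for all } t\in(0,T),$$ then for every $t\in[0,T]$ one has $y(\cdot,t)\in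 H^1(0,1)$ and $$\|y(\cdot,t)\|_{H^1(0,1)}\le\exp\Big\{-\frac{(2\pi^2-1)\rho t}{2(\pi^2+1)}\Big\}\|y_0\|_{H^1(0,1)},$$ where $\|u\|_{H^1(0,1)}=\big(\|u\|_{L^2(0,1)}^2+\|u_x\|_{L^2(0,1)}^2\big)^{1/2}$. -/

import Mathlib

open MeasureTheory Set
open scoped ENNReal ContDiff

noncomputable section

namespace QuasilinearDecay

section WeakDerivatives

variable {E : Type*} [NormedAddCommGroup E] [NormedSpace ℝ E] [MeasureSpace E]

/-- `φ ∈ C_c^∞(U)`. -/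
structure IsTestFunction (U : Set E) (φ : E → ℝ) : Prop where
  smooth : ContDiff ℝ ∞ φ
  compact : HasCompactSupport φ
  support_subset : tsupport φ ⊆ U

/-- `g` is the weak derivative of `u` on the open set `U` in the direction `v`. -/
structure HasWeakDeriv (U : Set E) (v : E) (u g : E → ℝ) : Prop where
  locInt : LocallyIntegrableOn u U
  locInt_deriv : LocallyIntegrableOn g U
  integral_eq : ∀ φ : E → ℝ, IsTestFunction U φ →
    ∫ x in U, u x * fderiv ℝ φ x v = -∫ x in U, g x * φ x

open Classical in
/-- The weak derivative of `u` on `U` in the direction `v` (zero if there is none). It is unique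
up to equality almost everywhere on `U`, see `HasWeakDeriv.ae_eq`. -/
def weakDeriv (U : Set E) (v : E) (u : E → ℝ) : E → ℝ :=
  if h : ∃ g, HasWeakDeriv U v u g then h.choose else 0

theorem HasWeakDeriv.ae_eq [FiniteDimensional ℝ E] [BorelSpace E] {U : Set E} (hU : IsOpen U)
    {v : E} {u g₁ g₂ : E → ℝ}
    (h₁ : HasWeakDeriv U v u g₁) (h₂ : HasWeakDeriv U v u g₂) :
    g₁ =ᵐ[volume.restrict U] g₂ := by
  have hint : ∀ {g : E → ℝ}, LocallyIntegrableOn g U → ∀ φ : E → ℝ, IsTestFunction U φ →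
      IntegrableOn (fun x => g x * φ x) U := by
    intro g hg φ hφ
    have hK : IntegrableOn g (tsupport φ) :=
      hg.integrableOn_compact_subset hφ.support_subset hφ.compact
    have h := (hK.mul_continuousOn hφ.smooth.continuous.continuousOn hφ.compact)
    have h' : Integrable (fun x => g x * φ x) := by
      rw [← integrableOn_iff_integrable_of_support_subset (s := tsupport φ)]
      · exact h
      · intro x hx
        exact subset_tsupport φ (right_ne_zero_of_mul hx)
    exact h'.integrableOn
  have key : ∀ᵐ x ∂(volume : Measure E), x ∈ U → (g₁ - g₂) x = 0 := by
    refine hU.ae_eq_zero_of_integral_contDiff_smul_eq_zero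
      (h₁.locInt_deriv.sub h₂.locInt_deriv) ?_
    intro φ hs hc hsub
    have hφ : IsTestFunction U φ := ⟨hs, hc, hsub⟩
    have e := (h₁.integral_eq φ hφ).symm.trans (h₂.integral_eq φ hφ)
    have i₁ := hint h₁.locInt_deriv φ hφ
    have i₂ := hint h₂.locInt_deriv φ hφ
    rw [← setIntegral_eq_integral_of_forall_compl_eq_zero (s := U)]
    · have : ∀ x, φ x • (g₁ - g₂) x = g₁ x * φ x - g₂ x * φ x := by
        intro x; simp only [Pi.sub_apply, smul_eq_mul]; ring
      simp only [this]
      rw [integral_sub i₁ i₂]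
      linarith
    · intro x hx
      have : φ x = 0 := image_eq_zero_of_notMem_tsupport fun h => hx (hsub h)
      simp [this]
  filter_upwards [(ae_restrict_iff' hU.measurableSet).2 key] with x hx
  exact sub_eq_zero.1 hx

end WeakDerivatives

/-- The interval `(0,1)`. -/
abbrev I : Set ℝ := Ioo 0 1

/-- The parabolic cylinder `Q_T = (0,1) × (0,T)`; points are pairs `(x, t)`. -/
abbrev Q (T : ℝ) : Set (ℝ × ℝ) := Ioo 0 1 ×ˢ Ioo 0 T

/-- `u ∈ H¹(0,1)`. -/
def MemH1 (u : ℝ → ℝ) : Prop :=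
  MemLp u 2 (volume.restrict I) ∧
    ∃ g, HasWeakDeriv I 1 u g ∧ MemLp g 2 (volume.restrict I)

/-- The norm `‖u‖_{H¹(0,1)} = (‖u‖²_{L²} + ‖u_x‖²_{L²})^{1/2}` of a function `u ∈ H¹(0,1)`. -/
def h1Norm (u : ℝ → ℝ) : ℝ :=
  Real.sqrt ((∫ x in I, u x ^ 2) + ∫ x in I, weakDeriv I 1 u x ^ 2)

/-- `u ∈ H¹₀(0,1)`, the closure of `C_c^∞(0,1)` in `H¹(0,1)`. -/
def MemH1Zero (u : ℝ → ℝ) : Prop :=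
  MemH1 u ∧ ∀ ε > 0, ∃ φ : ℝ → ℝ, IsTestFunction I φ ∧ h1Norm (u - φ) < ε

/-- `C₀` is a constant for which
`‖u_x‖_{L⁴} ≤ C₀ ‖u‖_{L^∞}^{1/2} ‖u_xx‖_{L²}^{1/2} + C₀ ‖u‖_{L²}` on `(0,1)`
for all `u ∈ H²(0,1)` (with weak derivatives `u₁ = u_x` and `u₂ = u_xx`). -/
def IsGagliardoNirenbergConst (C₀ : ℝ) : Prop :=
  0 < C₀ ∧ ∀ u u₁ u₂ : ℝ → ℝ,
    MemLp u 2 (volume.restrict I) → MemLp u₁ 2 (volume.restrict I) →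
    MemLp u₂ 2 (volume.restrict I) → HasWeakDeriv I 1 u u₁ → HasWeakDeriv I 1 u₁ u₂ →
    eLpNorm u₁ 4 (volume.restrict I) ≤
      ENNReal.ofReal C₀ * eLpNorm u ∞ (volume.restrict I) ^ (1 / 2 : ℝ) *
          eLpNorm u₂ 2 (volume.restrict I) ^ (1 / 2 : ℝ) +
        ENNReal.ofReal C₀ * eLpNorm u 2 (volume.restrict I)

/-- `y ∈ W^{2,1}_2(Q_T)`, with weak derivatives `y_x = yx`, `y_xx = yxx`, `y_t = yt`. -/
structure IsW212 (T : ℝ) (y yx yxx yt : ℝ × ℝ → ℝ) : Prop where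
  memLp : MemLp y 2 (volume.restrict (Q T))
  memLp_x : MemLp yx 2 (volume.restrict (Q T))
  memLp_xx : MemLp yxx 2 (volume.restrict (Q T))
  memLp_t : MemLp yt 2 (volume.restrict (Q T))
  deriv_x : HasWeakDeriv (Q T) (1, 0) y yx
  deriv_xx : HasWeakDeriv (Q T) (1, 0) yx yxx
  deriv_t : HasWeakDeriv (Q T) (0, 1) y yt

/-- `y` is a solution in `W^{2,1}_2(Q_T)`, with zero lateral boundary values, of
`y_t - (a(y) y_x)_x = 0` in `Q_T`, `y(0,t) = y(1,t) = 0`, `y(x,0) = y₀(x)`.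
An element of `W^{2,1}_2(Q_T)` is represented by its continuous representative on
`[0,1] × [0,T]`, so that boundary values, initial values and time slices are pointwise. -/
structure IsSolution (a : ℝ → ℝ) (T : ℝ) (y₀ : ℝ → ℝ) (y : ℝ × ℝ → ℝ) : Prop where
  continuousOn : ContinuousOn y (Icc 0 1 ×ˢ Icc 0 T)
  equation : ∃ yx yxx yt : ℝ × ℝ → ℝ, IsW212 T y yx yxx yt ∧
    HasWeakDeriv (Q T) (1, 0) (fun p => a (y p) * yx p) yt
  boundary : ∀ t ∈ Ioo 0 T, y (0, t) = 0 ∧ y (1, t) = 0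
  initial : ∀ᵐ x ∂(volume.restrict I), y (x, 0) = y₀ x

end QuasilinearDecay

end

/-! Write `A`, `B`, `D` for the L² norms of y, y_x, y_xx on a time slice and E = A² + B². Formally
E' = 2∫(y - y_xx) y_t, and inserting the equation gives ½E' ≤ -ρB² - ρD² + M‖y_x‖₄² D. The
Gagliardo–Nirenberg inequality, squared, together with A ≤ ‖y‖_∞ and the smallness of ‖y‖_∞, bounds
the last term by (ρ/2)(D² + AD). Since y vanishes at both endpoints, 2A ≤ B and B² ≤ AD, hence 4A ≤
D and (D² - AD)/2 ≥ A². Therefore E' ≤ -2ρE. This is `integral_sub_mul_flux_deriv_le`; it yields the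
decay rate ρ for the norm, which is stronger than the stated rate.

The regularity W^{2,1}_2 supplies no y_xt, so E is not differentiated directly. Convexity of E
(`energy_sub_le`) bounds E(t) - E(t-h) by 2∫(y - y_xx)(t)·(y(t) - y(t-h)), and the last factor is an
integral of y_t over (t-h, t). After integration against e^{2ρt} over (0, τ), the right side becomes
∫₀ʰ Ψ(r) dr, where Ψ pairs y - y_xx with y_t translated by r in time. Translations are continuous in
L², so Ψ is continuous, and Ψ(0) is controlled by the dissipation estimate. Dividing by h and
letting h → 0 bounds the averages of e^{2ρt}E just before τ by E(0), up to ε. Good slices therefore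
exist arbitrarily close to τ, and weak lower semicontinuity of the H¹ norm
(`exists_hasWeakDeriv_slice`) transfers the bound to every τ.

To work on slices, weak derivatives on the cylinder are restricted to almost every line
(`HasWeakDeriv.ae_slice`), and the du Bois-Reymond lemma then provides absolutely continuous
representatives. The existence of a Gagliardo–Nirenberg constant is proved separately, by elementary
one-dimensional estimates. -/

namespace QuasilinearDecay

open Filter Topology

/-! ### Absolutely continuous functions on an interval -/

/-- `u` is absolutely continuous on `[a, b]` with derivative `g` almost everywhere. -/
structure ACDeriv (u g : ℝ → ℝ) (a b : ℝ) : Prop where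
  ac : AbsolutelyContinuousOnInterval u a b
  deriv : ∀ᵐ x, x ∈ uIcc a b → HasDerivAt u (g x) x

theorem setIntegral_Ioo {a b : ℝ} (hab : a ≤ b) (f : ℝ → ℝ) :
    ∫ x in Ioo a b, f x = ∫ x in a..b, f x := by
  rw [intervalIntegral.integral_of_le hab, integral_Ioc_eq_integral_Ioo]

theorem intervalIntegrable_iff_Ioo {a b : ℝ} (hab : a ≤ b) {f : ℝ → ℝ} :
    IntervalIntegrable f volume a b ↔ IntegrableOn f (Ioo a b) := by
  rw [intervalIntegrable_iff_integrableOn_Ioc_of_le hab, integrableOn_Ioc_iff_integrableOn_Ioo]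

theorem ae_mem_Ioo_of_mem_uIcc {a b : ℝ} (hab : a ≤ b) :
    ∀ᵐ x : ℝ, x ∈ uIcc a b → x ∈ Ioo a b := by
  have h₁ : ∀ᵐ x : ℝ, x ≠ a := by simp [ae_iff, measure_singleton]
  have h₂ : ∀ᵐ x : ℝ, x ≠ b := by simp [ae_iff, measure_singleton]
  filter_upwards [h₁, h₂] with x h1 h2 hx
  rw [uIcc_of_le hab] at hx
  exact ⟨lt_of_le_of_ne hx.1 h1.symm, lt_of_le_of_ne hx.2 h2⟩

namespace ACDeriv

variable {u v g w : ℝ → ℝ} {a b : ℝ}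

theorem deriv_eq (h : ACDeriv u g a b) : ∀ᵐ x, x ∈ uIcc a b → _root_.deriv u x = g x := by
  filter_upwards [h.deriv] with x hx hm
  exact (hx hm).deriv

theorem intervalIntegrable (h : ACDeriv u g a b) : IntervalIntegrable g volume a b := by
  refine h.ac.intervalIntegrable_deriv.congr_ae ?_
  rw [EventuallyEq, ae_restrict_iff' measurableSet_uIoc]
  filter_upwards [h.deriv_eq] with x hx hm
  exact hx (uIoc_subset_uIcc hm)

theorem mono {c d : ℝ} (h : ACDeriv u g a b) (hs : uIcc c d ⊆ uIcc a b) : ACDeriv u g c d :=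
  ⟨h.ac.mono hs, by filter_upwards [h.deriv] with x hx hm using hx (hs hm)⟩

theorem integral_eq_sub (h : ACDeriv u g a b) : ∫ x in a..b, g x = u b - u a := by
  rw [← h.ac.integral_deriv_eq_sub]
  refine intervalIntegral.integral_congr_ae ?_
  filter_upwards [h.deriv_eq] with x hx hm
  exact (hx (uIoc_subset_uIcc hm)).symm

theorem integral_eq_sub' (h : ACDeriv u g a b) {c d : ℝ} (hc : c ∈ uIcc a b) (hd : d ∈ uIcc a b) :
    ∫ x in c..d, g x = u d - u c :=
  (h.mono (uIcc_subset_uIcc hc hd)).integral_eq_sub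

theorem continuousOn (h : ACDeriv u g a b) : ContinuousOn u (uIcc a b) := h.ac.continuousOn

theorem mul (hu : ACDeriv u g a b) (hv : ACDeriv v w a b) :
    ACDeriv (fun x => u x * v x) (fun x => g x * v x + u x * w x) a b :=
  ⟨hu.ac.fun_mul hv.ac, by
    filter_upwards [hu.deriv, hv.deriv] with x h1 h2 hm using (h1 hm).mul (h2 hm)⟩

theorem sub (hu : ACDeriv u g a b) (hv : ACDeriv v w a b) :
    ACDeriv (fun x => u x - v x) (fun x => g x - w x) a b :=
  ⟨hu.ac.fun_sub hv.ac, by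
    filter_upwards [hu.deriv, hv.deriv] with x h1 h2 hm using (h1 hm).sub (h2 hm)⟩

theorem const (c a b : ℝ) : ACDeriv (fun _ => c) (fun _ => 0) a b :=
  ⟨(contDiff_const.contDiffOn (n := 1)).absolutelyContinuousOnInterval,
    Eventually.of_forall fun x _ => hasDerivAt_const x c⟩

theorem of_contDiff (hu : ContDiff ℝ 1 u) (a b : ℝ) : ACDeriv u (_root_.deriv u) a b :=
  ⟨hu.contDiffOn.absolutelyContinuousOnInterval,
    Eventually.of_forall fun x _ => (hu.differentiable one_ne_zero x).hasDerivAt⟩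

theorem of_integral (hg : IntervalIntegrable g volume a b) (c : ℝ) :
    ACDeriv (fun x => c + ∫ s in a..x, g s) g a b := by
  refine ⟨(ACDeriv.const c a b).ac.fun_add
    (hg.absolutelyContinuousOnInterval_intervalIntegral (c := a) (by simp)), ?_⟩
  filter_upwards [hg.ae_hasDerivAt_integral] with x hx hm
  exact (hx hm a (by simp)).const_add c

theorem congr (hu : ACDeriv u g a b) (hab : a ≤ b) (h : EqOn v u (uIcc a b))
    (hw : ∀ᵐ x, x ∈ Ioo a b → w x = g x) : ACDeriv v w a b := by
  refine ⟨?_, ?_⟩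
  · have := hu.ac
    rw [absolutelyContinuousOnInterval_iff] at this ⊢
    intro ε hε
    obtain ⟨δ, hδ, H⟩ := this ε hε
    refine ⟨δ, hδ, fun E hE hs => ?_⟩
    convert H E hE hs using 2 with i hi
    have := hE.1 i hi
    rw [h this.1, h this.2]
  -- Agreement on the closed interval transfers derivatives only at interior points; the endpoints
  -- are a null set.
  · filter_upwards [hu.deriv, hw, ae_mem_Ioo_of_mem_uIcc hab] with x hx h1 h2 hm
    have hm' := h2 hm
    rw [h1 hm']
    refine (hx hm).congr_of_eventuallyEq ?_
    filter_upwards [Ioo_mem_nhds hm'.1 hm'.2] with z hz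
    exact h (by rw [uIcc_of_le hab]; exact Ioo_subset_Icc_self hz)

/-- If `u' = p` is continuous, then `F ∘ u` is again absolutely continuous. -/
theorem comp_of_contDiff {F p : ℝ → ℝ} (hu : ACDeriv u p a b) (hF : ContDiff ℝ 1 F)
    (hp : ContinuousOn p (uIcc a b)) :
    ACDeriv (fun x => F (u x)) (fun x => _root_.deriv F (u x) * p x) a b := by
  refine ⟨?_, ?_⟩
  -- A bound on `p` makes `u` Lipschitz, and `F` is Lipschitz on a ball containing the range of `u`;
  -- so the composition is Lipschitz.
  · obtain ⟨C, hC⟩ := isCompact_uIcc.exists_bound_of_continuousOn hp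
    have hLu : LipschitzOnWith C.toNNReal u (uIcc a b) := by
      refine LipschitzOnWith.of_dist_le_mul fun x hx z hz => ?_
      rw [Real.dist_eq, ← hu.integral_eq_sub' hz hx, ← Real.norm_eq_abs]
      refine (intervalIntegral.norm_integral_le_of_norm_le_const (C := C) fun s hs => ?_).trans ?_
      · exact hC s (uIcc_subset_uIcc hz hx (uIoc_subset_uIcc hs))
      · rw [Real.dist_eq]
        gcongr
        exact Real.le_coe_toNNReal C
    have himg : IsCompact (u '' uIcc a b) := isCompact_uIcc.image_of_continuousOn hu.continuousOn
    obtain ⟨R, hR⟩ := himg.isBounded.subset_closedBall 0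
    obtain ⟨K, hK⟩ := (hF.contDiffOn (s := Metric.closedBall 0 R)).exists_lipschitzOnWith
      one_ne_zero (convex_closedBall _ _) (isCompact_closedBall _ _)
    exact (hK.comp hLu fun x hx => hR (mem_image_of_mem u hx)).absolutelyContinuousOnInterval
  · filter_upwards [hu.deriv] with x hx hm
    exact ((hF.differentiable one_ne_zero (u x)).hasDerivAt).comp x (hx hm)

theorem integral_mul_add (hu : ACDeriv u g a b) (hv : ACDeriv v w a b) :
    ∫ x in a..b, (g x * v x + u x * w x) = u b * v b - u a * v a :=
  (hu.mul hv).integral_eq_sub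

end ACDeriv

/-! ### Weak derivatives on an interval and the du Bois-Reymond lemma -/

theorem IsTestFunction.eq_zero_of_notMem {U : Set ℝ} {φ : ℝ → ℝ} (h : IsTestFunction U φ) {x : ℝ}
    (hx : x ∉ U) : φ x = 0 :=
  image_eq_zero_of_notMem_tsupport fun h' => hx (h.support_subset h')

theorem fderiv_apply_one (φ : ℝ → ℝ) (x : ℝ) : fderiv ℝ φ x 1 = deriv φ x := rfl

theorem ACDeriv.hasWeakDeriv {u g : ℝ → ℝ} {a b : ℝ} (hab : a ≤ b) (h : ACDeriv u g a b) :
    HasWeakDeriv (Ioo a b) 1 u g := by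
  have hu : IntegrableOn u (Ioo a b) := by
    rw [← intervalIntegrable_iff_Ioo hab]
    exact h.continuousOn.intervalIntegrable
  have hg : IntegrableOn g (Ioo a b) := (intervalIntegrable_iff_Ioo hab).1 h.intervalIntegrable
  refine ⟨hu.locallyIntegrableOn, hg.locallyIntegrableOn, fun φ hφ => ?_⟩
  have hφ1 : ContDiff ℝ 1 φ := hφ.smooth.of_le (by exact_mod_cast le_top)
  have hφ' := ACDeriv.of_contDiff hφ1 a b
  have key := h.integral_mul_add hφ'
  rw [hφ.eq_zero_of_notMem (by simp), hφ.eq_zero_of_notMem (by simp)] at key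
  rw [intervalIntegral.integral_add
    (h.intervalIntegrable.mul_continuousOn hφ'.continuousOn)
    (hφ'.intervalIntegrable.continuousOn_mul h.continuousOn)] at key
  simp only [fderiv_apply_one]
  rw [setIntegral_Ioo hab, setIntegral_Ioo hab]
  linarith

theorem HasWeakDeriv.congr {E : Type*} [NormedAddCommGroup E] [NormedSpace ℝ E] [MeasureSpace E]
    [OpensMeasurableSpace E] {U : Set E} {v : E} {u₁ u₂ g₁ g₂ : E → ℝ}
    (h : HasWeakDeriv U v u₁ g₁) (hu : u₁ =ᵐ[volume.restrict U] u₂)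
    (hg : g₁ =ᵐ[volume.restrict U] g₂) : HasWeakDeriv U v u₂ g₂ := by
  have loc : ∀ {f₁ f₂ : E → ℝ}, f₁ =ᵐ[volume.restrict U] f₂ → LocallyIntegrableOn f₁ U →
      LocallyIntegrableOn f₂ U := by
    intro f₁ f₂ hf h1 x hx
    obtain ⟨s, hs, hi⟩ := h1 x hx
    refine ⟨s ∩ U, inter_mem hs self_mem_nhdsWithin, ?_⟩
    exact (hi.mono_set inter_subset_left).congr
      (ae_mono (Measure.restrict_mono inter_subset_right le_rfl) hf)
  refine ⟨loc hu h.locInt, loc hg h.locInt_deriv, fun φ hφ => ?_⟩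
  have e1 : ∫ x in U, u₂ x * fderiv ℝ φ x v = ∫ x in U, u₁ x * fderiv ℝ φ x v :=
    integral_congr_ae (by filter_upwards [hu] with x hx; rw [hx])
  have e2 : ∫ x in U, g₂ x * φ x = ∫ x in U, g₁ x * φ x :=
    integral_congr_ae (by filter_upwards [hg] with x hx; rw [hx])
  rw [e1, e2]
  exact h.integral_eq φ hφ

/-- A normalized test function on an interval. -/
theorem exists_testFunction_integral_eq_one {a b : ℝ} (hab : a < b) :
    ∃ η : ℝ → ℝ, IsTestFunction (Ioo a b) η ∧ ∫ x in a..b, η x = 1 := by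
  let f : ContDiffBump ((a + b) / 2) := ⟨(b - a) / 8, (b - a) / 4, by linarith, by linarith⟩
  have hsupp : tsupport (f.normed volume) ⊆ Ioo a b := by
    rw [f.tsupport_normed_eq, Real.closedBall_eq_Icc]
    intro x hx
    simp only [f, mem_Icc] at hx
    exact ⟨by linarith [hx.1], by linarith [hx.2]⟩
  refine ⟨f.normed volume, ⟨f.contDiff_normed, f.hasCompactSupport_normed, hsupp⟩, ?_⟩
  rw [← setIntegral_Ioo hab.le, setIntegral_eq_integral_of_forall_compl_eq_zero]
  · exact f.integral_normed
  · intro x hx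
    exact image_eq_zero_of_notMem_tsupport fun h' => hx (hsupp h')

/-- Left of the support of `ψ` the primitive has not started; right of it, it equals the total
integral, which is zero. Mean zero is thus what makes `ψ` the derivative of a test function. -/
theorem IsTestFunction.primitive {a b : ℝ} {ψ : ℝ → ℝ} (hψ : IsTestFunction (Ioo a b) ψ)
    (hab : a < b) (h0 : ∫ x in a..b, ψ x = 0) :
    IsTestFunction (Ioo a b) (fun x => ∫ s in a..x, ψ s) ∧
      deriv (fun x => ∫ s in a..x, ψ s) = ψ := by
  have hc : Continuous ψ := hψ.smooth.continuous
  have hd : ∀ x, HasDerivAt (fun x => ∫ s in a..x, ψ s) (ψ x) x := fun x =>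
    hc.integral_hasStrictDerivAt a x |>.hasDerivAt
  have hder : deriv (fun x => ∫ s in a..x, ψ s) = ψ := funext fun x => (hd x).deriv
  -- the support of `ψ` sits in a smaller closed interval
  obtain ⟨c, d, hcd, hac, hdb, hsub⟩ : ∃ c d, c ≤ d ∧ a < c ∧ d < b ∧ tsupport ψ ⊆ Icc c d := by
    rcases (tsupport ψ).eq_empty_or_nonempty with he | hne
    · exact ⟨(a + b) / 2, (a + b) / 2, le_rfl, by linarith, by linarith, by simp [he]⟩
    · have hK : IsCompact (tsupport ψ) := hψ.compact
      obtain ⟨c, hc1, hc2⟩ := hK.exists_isLeast hne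
      obtain ⟨d, hd1, hd2⟩ := hK.exists_isGreatest hne
      exact ⟨c, d, hc2 hd1, (hψ.support_subset hc1).1, (hψ.support_subset hd1).2,
        fun x hx => ⟨hc2 hx, hd2 hx⟩⟩
  have hz : ∀ x, x ∉ Icc c d → ψ x = 0 := fun x hx =>
    image_eq_zero_of_notMem_tsupport fun h' => hx (hsub h')
  have hout : ∀ x, x ∉ Icc c d → ∫ s in a..x, ψ s = 0 := by
    intro x hx
    rw [mem_Icc, not_and_or, not_le, not_le] at hx
    rcases hx with hx | hx
    · refine (intervalIntegral.integral_congr (g := fun _ => 0) fun s hs => ?_).trans (by simp)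
      refine hz s fun hs' => ?_
      have := hs.2
      rw [le_sup_iff] at this
      rcases this with h | h <;> linarith [hs'.1]
    · rw [← intervalIntegral.integral_add_adjacent_intervals (hc.intervalIntegrable a b)
        (hc.intervalIntegrable b x), h0, zero_add]
      refine (intervalIntegral.integral_congr (g := fun _ => 0) fun s hs => ?_).trans (by simp)
      refine hz s fun hs' => ?_
      have := hs.1
      rw [inf_le_iff] at this
      rcases this with h | h <;> linarith [hs'.2]
  have hts : tsupport (fun x => ∫ s in a..x, ψ s) ⊆ Icc c d :=
    closure_minimal (fun x hx => by_contra fun h => hx (hout x h)) isClosed_Icc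
  refine ⟨⟨?_, ?_, ?_⟩, hder⟩
  · rw [contDiff_infty_iff_deriv, hder]
    exact ⟨fun x => (hd x).differentiableAt, hψ.smooth⟩
  · exact isCompact_Icc.of_isClosed_subset (isClosed_tsupport _) hts
  · exact hts.trans fun x hx => ⟨hac.trans_le hx.1, hx.2.trans_lt hdb⟩

theorem IsTestFunction.sub_smul {U : Set ℝ} {φ ψ : ℝ → ℝ} (hφ : IsTestFunction U φ)
    (hψ : IsTestFunction U ψ) (c : ℝ) : IsTestFunction U (fun x => φ x - c * ψ x) := by
  have hsub : tsupport (fun x => φ x - c * ψ x) ⊆ tsupport φ ∪ tsupport ψ := by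
    refine closure_minimal (fun x hx => ?_) ((isClosed_tsupport _).union (isClosed_tsupport _))
    by_contra h
    rw [mem_union, not_or] at h
    apply hx
    simp only
    rw [image_eq_zero_of_notMem_tsupport h.1, image_eq_zero_of_notMem_tsupport h.2]
    simp
  refine ⟨hφ.smooth.sub (contDiff_const.mul hψ.smooth), ?_,
    hsub.trans (union_subset hφ.support_subset hψ.support_subset)⟩
  exact (IsCompact.union hφ.compact hψ.compact).of_isClosed_subset (isClosed_tsupport _) hsub

/-- du Bois-Reymond: a function with an integrable weak derivative has an absolutely continuous
representative. -/
theorem HasWeakDeriv.exists_acDeriv {a b : ℝ} (hab : a < b) {u g : ℝ → ℝ}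
    (h : HasWeakDeriv (Ioo a b) 1 u g) (hu : IntegrableOn u (Ioo a b))
    (hg : IntegrableOn g (Ioo a b)) :
    ∃ v, ACDeriv v g a b ∧ u =ᵐ[volume.restrict (Ioo a b)] v := by
  obtain ⟨η, hη, hη1⟩ := exists_testFunction_integral_eq_one hab
  have hgi := (intervalIntegrable_iff_Ioo hab.le).2 hg
  have hui := (intervalIntegrable_iff_Ioo hab.le).2 hu
  have hG := ACDeriv.of_integral hgi 0
  set G : ℝ → ℝ := fun x => 0 + ∫ s in a..x, g s with hGdef
  have hGi : IntervalIntegrable G volume a b := hG.continuousOn.intervalIntegrable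
  have hw := hG.hasWeakDeriv hab.le
  -- The difference `u - G` has zero weak derivative, so it should be constant; pairing with `η`, of
  -- integral one, reveals the constant.
  set c : ℝ := ∫ x in a..b, (u x - G x) * η x with hc
  have hdi : IntervalIntegrable (fun x => u x - G x) volume a b := hui.sub hGi
  have key : ∀ᵐ x ∂(volume : Measure ℝ), x ∈ Ioo a b → (u x - G x - c) = 0 := by
    refine isOpen_Ioo.ae_eq_zero_of_integral_contDiff_smul_eq_zero
      (f := fun x => u x - G x - c) ?_ ?_
    · exact ((intervalIntegrable_iff_Ioo hab.le).1
        (hdi.sub intervalIntegrable_const)).locallyIntegrableOn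
    intro ζ hs hcs hsub
    have hζ : IsTestFunction (Ioo a b) ζ := ⟨hs, hcs, hsub⟩
    set m : ℝ := ∫ x in a..b, ζ x with hm
    -- Subtracting `m η` removes the mean of `ζ`, so the primitive is an admissible test function.
    have hψ := hζ.sub_smul hη m
    have hζi : IntervalIntegrable ζ volume a b := hs.continuous.intervalIntegrable _ _
    have hηi : IntervalIntegrable η volume a b := hη.smooth.continuous.intervalIntegrable _ _
    have h0 : ∫ x in a..b, (ζ x - m * η x) = 0 := by
      rw [intervalIntegral.integral_sub hζi (hηi.const_mul m),
        intervalIntegral.integral_const_mul, hη1, ← hm]; ring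
    obtain ⟨hP, hPd⟩ := hψ.primitive hab h0
    have e1 := h.integral_eq _ hP
    have e2 := hw.integral_eq _ hP
    simp only [fderiv_apply_one, hPd] at e1 e2
    have e3 := e1.trans e2.symm
    rw [setIntegral_Ioo hab.le, setIntegral_Ioo hab.le] at e3
    have i1 : IntervalIntegrable (fun x => u x * (ζ x - m * η x)) volume a b :=
      hui.mul_continuousOn hψ.smooth.continuous.continuousOn
    have i2 : IntervalIntegrable (fun x => G x * (ζ x - m * η x)) volume a b :=
      hGi.mul_continuousOn hψ.smooth.continuous.continuousOn
    have i3 : IntervalIntegrable (fun x => (u x - G x) * ζ x) volume a b :=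
      hdi.mul_continuousOn hs.continuous.continuousOn
    have i4 : IntervalIntegrable (fun x => (u x - G x) * η x) volume a b :=
      hdi.mul_continuousOn hη.smooth.continuous.continuousOn
    have e4 : (∫ x in a..b, (u x - G x) * ζ x) - m * c = 0 := by
      rw [hc, ← intervalIntegral.integral_const_mul, ← intervalIntegral.integral_sub i3
        (i4.const_mul m), ← sub_eq_zero.2 e3, ← intervalIntegral.integral_sub i1 i2]
      congr 1; ext x; ring
    have e5 : ∫ x in Ioo a b, ζ x • (u x - G x - c) = 0 := by
      rw [setIntegral_Ioo hab.le, ← e4, hm, mul_comm, ← intervalIntegral.integral_const_mul,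
        ← intervalIntegral.integral_sub i3 (hζi.const_mul c)]
      congr 1; ext x; simp only [smul_eq_mul]; ring
    rw [← e5, setIntegral_eq_integral_of_forall_compl_eq_zero]
    intro x hx
    rw [hζ.eq_zero_of_notMem hx, zero_smul]
  refine ⟨_, ACDeriv.of_integral hgi c, ?_⟩
  filter_upwards [(ae_restrict_iff' measurableSet_Ioo).2 key] with x hx
  simp only [hGdef] at hx
  linarith

/-! ### Cauchy–Schwarz and pointwise estimates -/

section CauchySchwarz

variable {α : Type*} [MeasurableSpace α] {μ : Measure α} {f g : α → ℝ}

theorem memLp_two_iff_sq (hf : AEStronglyMeasurable f μ) :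
    MemLp f 2 μ ↔ Integrable (fun x => f x ^ 2) μ := memLp_two_iff_integrable_sq hf

theorem integrable_mul_of_memLp_two (hf : MemLp f 2 μ) (hg : MemLp g 2 μ) :
    Integrable (fun x => f x * g x) μ := hf.integrable_mul hg

/-- The quadratic s ↦ ∫(f + s g)² is nonnegative, so its discriminant is not positive. -/
theorem integral_mul_sq_le (hf : MemLp f 2 μ) (hg : MemLp g 2 μ) :
    (∫ x, f x * g x ∂μ) ^ 2 ≤ (∫ x, f x ^ 2 ∂μ) * ∫ x, g x ^ 2 ∂μ := by
  have hff := hf.integrable_sq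
  have hgg := hg.integrable_sq
  have hfg : Integrable (fun x => f x * g x) μ := hf.integrable_mul hg
  have key : ∀ s : ℝ, 0 ≤ (∫ x, g x ^ 2 ∂μ) * (s * s) + (2 * ∫ x, f x * g x ∂μ) * s +
      ∫ x, f x ^ 2 ∂μ := by
    intro s
    have e : ∫ x, (f x + s * g x) ^ 2 ∂μ = (∫ x, g x ^ 2 ∂μ) * (s * s) +
        (2 * ∫ x, f x * g x ∂μ) * s + ∫ x, f x ^ 2 ∂μ := by
      have : ∀ x, (f x + s * g x) ^ 2 = s * s * g x ^ 2 + 2 * s * (f x * g x) + f x ^ 2 := by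
        intro x; ring
      simp only [this]
      have i1 := hgg.const_mul (s * s)
      have i2 := hfg.const_mul (2 * s)
      rw [integral_add (by exact i1.add i2) hff, integral_add i1 i2, integral_const_mul,
        integral_const_mul]
      ring
    rw [← e]
    exact integral_nonneg fun x => sq_nonneg _
  have := discrim_le_zero key
  rw [discrim] at this
  linarith

theorem abs_integral_mul_le (hf : MemLp f 2 μ) (hg : MemLp g 2 μ) :
    |∫ x, f x * g x ∂μ| ≤ √(∫ x, f x ^ 2 ∂μ) * √(∫ x, g x ^ 2 ∂μ) := by
  rw [← Real.sqrt_mul (integral_nonneg fun x => sq_nonneg _)]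
  exact Real.abs_le_sqrt (integral_mul_sq_le hf hg)

end CauchySchwarz

/-- By the fundamental theorem of calculus, continuity of `p` upgrades the almost everywhere
derivative to every interior point, as the mean value theorem requires. -/
theorem ACDeriv.hasDerivAt {u p : ℝ → ℝ} {a b : ℝ} (hab : a ≤ b) (hu : ACDeriv u p a b)
    (hp : ContinuousOn p (uIcc a b)) {x : ℝ} (hx : x ∈ Ioo a b) : HasDerivAt u (p x) x := by
  have hI : uIcc a b = Icc a b := uIcc_of_le hab
  have hxm : x ∈ uIcc a b := by rw [hI]; exact Ioo_subset_Icc_self hx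
  have hm : Icc a b ∈ 𝓝 x := Icc_mem_nhds hx.1 hx.2
  have h1 : HasDerivAt (fun z => u a + ∫ s in a..z, p s) (p x) x := by
    refine (intervalIntegral.integral_hasDerivAt_right ?_ ?_ ?_).const_add _
    · exact (hu.mono (uIcc_subset_uIcc_left hxm)).intervalIntegrable
    · exact ⟨Icc a b, hm, (hI ▸ hp).aestronglyMeasurable measurableSet_Icc⟩
    · exact (hI ▸ hp).continuousAt hm
  refine h1.congr_of_eventuallyEq ?_
  filter_upwards [hm] with z hz
  rw [hu.integral_eq_sub' left_mem_uIcc (by rwa [hI])]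
  ring

theorem ContinuousOn.memLp_Ioo {f : ℝ → ℝ} {a b : ℝ} (hf : ContinuousOn f (Icc a b)) (p : ℝ≥0∞) :
    MemLp f p (volume.restrict (Ioo a b)) := by
  obtain ⟨C, hC⟩ := isCompact_Icc.exists_bound_of_continuousOn hf
  refine MemLp.of_bound ((hf.mono Ioo_subset_Icc_self).aestronglyMeasurable measurableSet_Ioo) C ?_
  filter_upwards [ae_restrict_mem measurableSet_Ioo] with x hx
  exact hC x (Ioo_subset_Icc_self hx)

/-- Morrey's inequality on an interval. -/
theorem ACDeriv.abs_sub_le {p q : ℝ → ℝ} {a b : ℝ} (hab : a ≤ b) (hp : ACDeriv p q a b)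
    (hq : MemLp q 2 (volume.restrict (Ioo a b))) {x y : ℝ} (hx : x ∈ Icc a b) (hy : y ∈ Icc a b) :
    |p y - p x| ≤ √|y - x| * √(∫ s in Ioo a b, q s ^ 2) := by
  wlog hxy : x ≤ y generalizing x y
  · rw [abs_sub_comm, abs_sub_comm y x]
    exact this hy hx (not_le.1 hxy).le
  have hsub : Ioo x y ⊆ Ioo a b := Ioo_subset_Ioo hx.1 hy.2
  rw [← uIcc_of_le hab] at hx hy
  rw [← hp.integral_eq_sub' hx hy, ← setIntegral_Ioo hxy]
  have h1 : MemLp (fun _ : ℝ => (1 : ℝ)) 2 (volume.restrict (Ioo x y)) := memLp_const 1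
  have h2 : MemLp q 2 (volume.restrict (Ioo x y)) :=
    hq.mono_measure (Measure.restrict_mono hsub le_rfl)
  have := abs_integral_mul_le h1 h2
  simp only [one_mul, one_pow] at this
  refine this.trans ?_
  gcongr
  · simp [abs_of_nonneg (sub_nonneg.2 hxy), hxy]
  · exact Eventually.of_forall fun s => sq_nonneg _
  · exact hq.integrable_sq

/-! ### Existence of a Gagliardo–Nirenberg constant -/

section GagliardoNirenberg

variable {u p q : ℝ → ℝ} {N : ℝ}

/-- On an interval of length `l` containing `x`, the mean value theorem gives a point where `|p| ≤
2N / l`; Morrey's inequality carries this bound to `x`. The free length `l` is optimised later. -/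
theorem abs_deriv_le_of_length (hu : ACDeriv u p 0 1) (hp : ACDeriv p q 0 1)
    (hq : MemLp q 2 (volume.restrict I)) (hN : ∀ x ∈ Icc (0 : ℝ) 1, |u x| ≤ N) {l : ℝ} (hl0 : 0 < l)
    (hl1 : l ≤ 1) {x : ℝ} (hx : x ∈ Icc (0 : ℝ) 1) :
    |p x| ≤ 2 * N / l + √l * √(∫ s in I, q s ^ 2) := by
  obtain ⟨c, hc0, hc1, hcx, hxc⟩ : ∃ c, 0 ≤ c ∧ c + l ≤ 1 ∧ c ≤ x ∧ x ≤ c + l := by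
    rcases le_total (x + l) 1 with h | h
    · exact ⟨x, hx.1, h, le_rfl, by linarith⟩
    · exact ⟨1 - l, by linarith, by linarith, by linarith, by linarith [hx.2]⟩
  have hcs : Icc c (c + l) ⊆ Icc 0 1 := Icc_subset_Icc hc0 hc1
  obtain ⟨ξ, hξ, hs⟩ := exists_hasDerivAt_eq_slope u p (show c < c + l by linarith)
    (hu.continuousOn.mono (by rw [uIcc_of_le zero_le_one]; exact hcs))
    (fun z hz => hu.hasDerivAt zero_le_one hp.continuousOn
      ⟨hc0.trans_lt hz.1, hz.2.trans_le hc1⟩)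
  have hξ' : ξ ∈ Icc c (c + l) := Ioo_subset_Icc_self hξ
  have h1 : |p ξ| ≤ 2 * N / l := by
    rw [hs, add_sub_cancel_left, abs_div, abs_of_pos hl0]
    gcongr
    have h1 := hN c (hcs (left_mem_Icc.2 (by linarith)))
    have h2 := hN (c + l) (hcs (right_mem_Icc.2 (by linarith)))
    calc |u (c + l) - u c| ≤ |u (c + l)| + |u c| := abs_sub _ _
      _ ≤ 2 * N := by linarith
  have h2 := hp.abs_sub_le zero_le_one hq (hcs hξ') hx
  have h3 : √|x - ξ| ≤ √l := by
    apply Real.sqrt_le_sqrt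
    rw [abs_le]
    exact ⟨by linarith [hξ'.2], by linarith [hξ'.1]⟩
  have h4 : |p x| ≤ |p ξ| + |p x - p ξ| := by
    calc |p x| = |p ξ + (p x - p ξ)| := by ring_nf
      _ ≤ _ := abs_add_le _ _
  have h5 := mul_le_mul_of_nonneg_right h3 (Real.sqrt_nonneg (∫ s in I, q s ^ 2))
  linarith

theorem abs_deriv_pow_three_le (hu : ACDeriv u p 0 1) (hp : ACDeriv p q 0 1)
    (hq : MemLp q 2 (volume.restrict I)) (hN : ∀ x ∈ Icc (0 : ℝ) 1, |u x| ≤ N)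
    (hND : N ≤ √(∫ s in I, q s ^ 2)) {x : ℝ} (hx : x ∈ Icc (0 : ℝ) 1) :
    |p x| ^ 3 ≤ 64 * N * √(∫ s in I, q s ^ 2) ^ 2 := by
  set D := √(∫ s in I, q s ^ 2) with hD
  have hN0 : 0 ≤ N := (abs_nonneg _).trans (hN 0 (by simp))
  have hD0 : 0 ≤ D := Real.sqrt_nonneg _
  rcases le_or_gt (2 * D) |p x| with h | h
  · have := abs_deriv_le_of_length hu hp hq hN one_pos le_rfl hx
    rw [Real.sqrt_one, ← hD] at this
    have h4 : |p x| ≤ 4 * N := by linarith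
    calc |p x| ^ 3 ≤ (4 * N) ^ 3 := by gcongr
      _ = 64 * N * N ^ 2 := by ring
      _ ≤ _ := by gcongr
  · rcases eq_or_lt_of_le (abs_nonneg (p x)) with h0 | h0
    · rw [← h0, zero_pow three_ne_zero]; positivity
    have hDpos : 0 < D := by linarith
    have hP : 0 < |p x| / (2 * D) := by positivity
    have hP1 : |p x| / (2 * D) ≤ 1 := by rw [div_le_one (by positivity)]; exact h.le
    -- This `l` makes `√l * D` equal to `|p x| / 2`, which is absorbed on the left.
    have := abs_deriv_le_of_length hu hp hq hN (l := (|p x| / (2 * D)) ^ 2) (by positivity)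
      (pow_le_one₀ hP.le hP1) hx
    rw [Real.sqrt_sq hP.le, ← hD] at this
    have e1 : |p x| / (2 * D) * D = |p x| / 2 := by field_simp
    have e2 : 2 * N / (|p x| / (2 * D)) ^ 2 = 8 * N * D ^ 2 / |p x| ^ 2 := by
      field_simp; ring
    rw [e1, e2] at this
    have h6 : |p x| / 2 ≤ 8 * N * D ^ 2 / |p x| ^ 2 := by linarith
    rw [le_div_iff₀ (by positivity)] at h6
    nlinarith [mul_nonneg hN0 (sq_nonneg D)]

/-- Integrating (p³u)' = p⁴ + 3p²qu bounds ∫p⁴ by a Cauchy–Schwarz term and boundary values of p³u.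
The boundary values need not vanish; the cubic pointwise bound controls them. -/
theorem integral_deriv_pow_four_le (hu : ACDeriv u p 0 1) (hp : ACDeriv p q 0 1)
    (hq : MemLp q 2 (volume.restrict I)) (hN : ∀ x ∈ Icc (0 : ℝ) 1, |u x| ≤ N)
    (hND : N ≤ √(∫ s in I, q s ^ 2)) :
    √(∫ x in I, p x ^ 4) ≤ 14 * (N * √(∫ s in I, q s ^ 2)) := by
  set D := √(∫ s in I, q s ^ 2) with hD
  have hN0 : 0 ≤ N := (abs_nonneg _).trans (hN 0 (by simp))
  have hD0 : 0 ≤ D := Real.sqrt_nonneg _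
  have hpc : ContinuousOn p (Icc 0 1) := by simpa using hp.continuousOn
  have huc : ContinuousOn u (Icc 0 1) := by simpa using hu.continuousOn
  have hp3 := ((hp.mul hp).mul hp).mul hu
  have hint := hp3.integral_eq_sub
  have hb : ∀ x ∈ Icc (0 : ℝ) 1, |p x * p x * p x * u x| ≤ 64 * N * D ^ 2 * N := by
    intro x hx
    have h1 := abs_deriv_pow_three_le hu hp hq hN hND hx
    rw [abs_mul]
    have : |p x * p x * p x| = |p x| ^ 3 := by rw [abs_mul, abs_mul]; ring
    rw [this]
    exact mul_le_mul h1 (hN x hx) (abs_nonneg _) ((by positivity : (0:ℝ) ≤ |p x| ^ 3).trans h1)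
  set X := √(∫ x in I, p x ^ 4) with hX
  have hX0 : 0 ≤ X := Real.sqrt_nonneg _
  have hXsq : X ^ 2 = ∫ x in I, p x ^ 4 := Real.sq_sqrt (integral_nonneg fun x => by positivity)
  have hp2 : MemLp (fun x => p x ^ 2) 2 (volume.restrict I) :=
    ContinuousOn.memLp_Ioo (hpc.pow 2) 2
  have hqu : MemLp (fun x => q x * u x) 2 (volume.restrict I) := by
    have := (ContinuousOn.memLp_Ioo huc ∞).mul hq (r := 2)
    exact this
  have hcs := abs_integral_mul_le hp2 hqu
  have e4 : ∫ x in I, (p x ^ 2) ^ 2 = ∫ x in I, p x ^ 4 := by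
    congr 1; ext x; ring
  rw [e4, ← hX] at hcs
  have hquD : √(∫ x in I, (q x * u x) ^ 2) ≤ N * D := by
    rw [Real.sqrt_le_left (by positivity), mul_pow, hD,
      Real.sq_sqrt (integral_nonneg fun x => sq_nonneg _), ← integral_const_mul]
    refine setIntegral_mono_on hqu.integrable_sq (hq.integrable_sq.const_mul _) measurableSet_Ioo ?_
    intro x hx
    rw [mul_pow, mul_comm]
    gcongr ?_ * _
    rw [← sq_abs]
    gcongr
    exact hN x (Ioo_subset_Icc_self hx)
  have hi4 : Integrable (fun x => p x ^ 4) (volume.restrict I) :=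
    memLp_one_iff_integrable.1 (ContinuousOn.memLp_Ioo (hpc.pow 4) 1)
  have hi2 : Integrable (fun x => p x ^ 2 * (q x * u x)) (volume.restrict I) :=
    hp2.integrable_mul hqu
  have e5 : (∫ x in I, p x ^ 4) + 3 * ∫ x in I, p x ^ 2 * (q x * u x) =
      p 1 * p 1 * p 1 * u 1 - p 0 * p 0 * p 0 * u 0 := by
    rw [← hint, ← integral_const_mul, ← integral_add hi4 (hi2.const_mul 3),
      ← setIntegral_Ioo zero_le_one]
    congr 1; ext x; ring
  have hb0 := hb 0 (by simp)
  have hb1 := hb 1 (by simp)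
  have h7 : X * √(∫ x in I, (q x * u x) ^ 2) ≤ X * (N * D) := by gcongr
  have h8 : X ^ 2 ≤ 128 * (N * D) ^ 2 + 3 * (X * (N * D)) := by
    rw [abs_le] at hb0 hb1 hcs
    rw [hXsq]
    nlinarith [hb0.1, hb0.2, hb1.1, hb1.2, hcs.1, hcs.2]
  -- Since 128 + 3·14 < 14², the quadratic inequality `h8` excludes `X > 14 N D`.
  by_contra hcon
  rw [not_le] at hcon
  have : 0 ≤ N * D := by positivity
  nlinarith

/-- Here `|p| ≤ 3N`, so `|u|` stays above `N / 2` on an interval of length 1/6 touching a maximum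
point. Hence ∫u² ≥ N²/24 ≥ (N/5)², and 3N ≤ 15‖u‖₂. -/
theorem abs_deriv_le_l2Norm (hu : ACDeriv u p 0 1) (hp : ACDeriv p q 0 1)
    (hq : MemLp q 2 (volume.restrict I)) (hN : ∀ x ∈ Icc (0 : ℝ) 1, |u x| ≤ N)
    (hND : √(∫ s in I, q s ^ 2) < N) {x₀ : ℝ} (hx₀ : x₀ ∈ Icc (0 : ℝ) 1) (hmax : |u x₀| = N)
    {x : ℝ} (hx : x ∈ Icc (0 : ℝ) 1) : |p x| ≤ 15 * √(∫ s in I, u s ^ 2) := by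
  have hN0 : 0 < N := (Real.sqrt_nonneg _).trans_lt hND
  have hpb : ∀ x ∈ Icc (0 : ℝ) 1, |p x| ≤ 3 * N := by
    intro x hx
    have := abs_deriv_le_of_length hu hp hq hN one_pos le_rfl hx
    rw [Real.sqrt_one] at this
    linarith
  have huc : ContinuousOn u (Icc 0 1) := by simpa using hu.continuousOn
  obtain ⟨c, hc0, hc1, hcx, hxc⟩ : ∃ c, 0 ≤ c ∧ c + 1 / 6 ≤ 1 ∧ c ≤ x₀ ∧ x₀ ≤ c + 1 / 6 := by
    rcases le_total (x₀ + 1 / 6) 1 with h | h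
    · exact ⟨x₀, hx₀.1, h, le_rfl, by linarith⟩
    · exact ⟨1 - 1 / 6, by norm_num, by norm_num, by linarith, by linarith [hx₀.2]⟩
  have hlow : ∀ z ∈ Ioo c (c + 1 / 6), N ^ 2 / 4 ≤ u z ^ 2 := by
    intro z hz
    have hz1 : z ∈ uIcc (0 : ℝ) 1 := by
      rw [uIcc_of_le zero_le_one]; exact ⟨by linarith [hz.1], by linarith [hz.2]⟩
    have hx₀' : x₀ ∈ uIcc (0 : ℝ) 1 := by rwa [uIcc_of_le zero_le_one]
    have h1 : |u z - u x₀| ≤ N / 2 := by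
      rw [← hu.integral_eq_sub' hx₀' hz1, ← Real.norm_eq_abs]
      refine (intervalIntegral.norm_integral_le_of_norm_le_const (C := 3 * N)
        fun s hs => ?_).trans ?_
      · have := uIcc_subset_uIcc hx₀' hz1 (uIoc_subset_uIcc hs)
        rw [uIcc_of_le zero_le_one] at this
        exact hpb s this
      · have : |z - x₀| ≤ 1 / 6 := by
          rw [abs_le]; exact ⟨by linarith [hz.1], by linarith [hz.2]⟩
        nlinarith
    have h2 : |u x₀| ≤ |u z| + |u z - u x₀| := by
      have := abs_sub (u z) (u z - u x₀)
      rwa [sub_sub_cancel] at this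
    rw [← sq_abs (u z)]
    nlinarith [abs_nonneg (u z)]
  have hA : N ^ 2 / 24 ≤ ∫ s in I, u s ^ 2 := by
    have hui : IntegrableOn (fun s => u s ^ 2) I := (ContinuousOn.memLp_Ioo huc 2).integrable_sq
    have hsub : Ioo c (c + 1 / 6) ⊆ I := Ioo_subset_Ioo hc0 hc1
    calc N ^ 2 / 24 = ∫ s in Ioo c (c + 1 / 6), N ^ 2 / 4 := by
          simp; ring
      _ ≤ ∫ s in Ioo c (c + 1 / 6), u s ^ 2 :=
          setIntegral_mono_on (by simp) (hui.mono_set hsub) measurableSet_Ioo hlow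
      _ ≤ _ := setIntegral_mono_set hui (Eventually.of_forall fun s => sq_nonneg _)
          hsub.eventuallyLE
  have hA' : N / 5 ≤ √(∫ s in I, u s ^ 2) := by
    apply Real.le_sqrt_of_sq_le
    nlinarith
  linarith [hpb x hx]

end GagliardoNirenberg

theorem eLpNorm_two_eq {α : Type*} [MeasurableSpace α] {μ : Measure α} {f : α → ℝ}
    (hf : MemLp f 2 μ) : eLpNorm f 2 μ = ENNReal.ofReal √(∫ x, f x ^ 2 ∂μ) := by
  rw [hf.eLpNorm_eq_integral_rpow_norm (by norm_num) (by norm_num), Real.sqrt_eq_rpow]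
  norm_num

theorem eLpNorm_four_eq {α : Type*} [MeasurableSpace α] {μ : Measure α} {f : α → ℝ}
    (hf : MemLp f 4 μ) : eLpNorm f 4 μ = ENNReal.ofReal √√(∫ x, f x ^ 4 ∂μ) := by
  rw [hf.eLpNorm_eq_integral_rpow_norm (by norm_num) (by norm_num), Real.sqrt_eq_rpow,
    Real.sqrt_eq_rpow, ← Real.rpow_mul (integral_nonneg fun x => by positivity)]
  norm_num
  congr 3
  ext x
  exact (Even.pow_abs (by decide) (f x))

theorem exists_acDeriv_of_memLp {a b : ℝ} (hab : a < b) {u g : ℝ → ℝ}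
    (h : HasWeakDeriv (Ioo a b) 1 u g) (hu : MemLp u 2 (volume.restrict (Ioo a b)))
    (hg : MemLp g 2 (volume.restrict (Ioo a b))) :
    ∃ v, ACDeriv v g a b ∧ u =ᵐ[volume.restrict (Ioo a b)] v :=
  h.exists_acDeriv hab (hu.integrable (by norm_num)) (hg.integrable (by norm_num))

theorem abs_le_eLpNorm_top {u : ℝ → ℝ} {a b : ℝ} (hab : a < b) (hu : ContinuousOn u (Icc a b))
    {x : ℝ} (hx : x ∈ Icc a b) : |u x| ≤ (eLpNorm u ∞ (volume.restrict (Ioo a b))).toReal := by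
  set N := (eLpNorm u ∞ (volume.restrict (Ioo a b))).toReal
  have hfin := (ContinuousOn.memLp_Ioo hu ∞).eLpNorm_ne_top
  have hae : ∀ᵐ x ∂volume.restrict (Icc a b), |u x| ≤ N := by
    rw [← restrict_Ioo_eq_restrict_Icc]
    filter_upwards [ae_le_eLpNormEssSup (f := u) (μ := volume.restrict (Ioo a b))] with x hx
    rw [← eLpNorm_exponent_top, ← ENNReal.ofReal_toReal hfin, Real.enorm_eq_ofReal_abs] at hx
    exact (ENNReal.ofReal_le_ofReal_iff ENNReal.toReal_nonneg).1 hx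
  -- The almost everywhere inequality is recast as an equality of continuous functions, which then
  -- holds on the whole closed interval.
  have h1 : (fun x => max |u x| N) =ᵐ[volume.restrict (Icc a b)] fun _ => N := by
    filter_upwards [hae] with x hx using max_eq_right hx
  have := Measure.eqOn_Icc_of_ae_eq volume hab.ne h1 (ContinuousOn.sup hu.abs continuousOn_const)
    continuousOn_const hx
  exact max_eq_right_iff.1 this

theorem exists_gagliardoNirenbergConst : ∃ C₀ : ℝ, IsGagliardoNirenbergConst C₀ := by
  refine ⟨15, by norm_num, fun u u₁ u₂ hu hu₁ hu₂ h₁ h₂ => ?_⟩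
  obtain ⟨p, hp, hpe⟩ := exists_acDeriv_of_memLp one_pos h₂ hu₁ hu₂
  obtain ⟨v, hv', hve⟩ := exists_acDeriv_of_memLp one_pos h₁ hu hu₁
  have hv : ACDeriv v p 0 1 := hv'.congr zero_le_one (fun _ _ => rfl)
    ((ae_restrict_iff' measurableSet_Ioo).1 hpe.symm)
  rw [eLpNorm_congr_ae hpe, eLpNorm_congr_ae hve, eLpNorm_congr_ae hve]
  have hvc : ContinuousOn v (Icc 0 1) := by simpa using hv.continuousOn
  have hpc : ContinuousOn p (Icc 0 1) := by simpa using hp.continuousOn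
  set N := (eLpNorm v ∞ (volume.restrict I)).toReal with hNdef
  have hNe : eLpNorm v ∞ (volume.restrict I) = ENNReal.ofReal N :=
    (ENNReal.ofReal_toReal (ContinuousOn.memLp_Ioo hvc ∞).eLpNorm_ne_top).symm
  have hN : ∀ x ∈ Icc (0 : ℝ) 1, |v x| ≤ N := fun x hx => abs_le_eLpNorm_top one_pos hvc hx
  rw [eLpNorm_four_eq (ContinuousOn.memLp_Ioo hpc 4), eLpNorm_two_eq hu₂,
    eLpNorm_two_eq (ContinuousOn.memLp_Ioo hvc 2), hNe,
    ENNReal.ofReal_rpow_of_nonneg ENNReal.toReal_nonneg (by norm_num),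
    ENNReal.ofReal_rpow_of_nonneg (Real.sqrt_nonneg _) (by norm_num),
    ← ENNReal.ofReal_mul (by norm_num), ← ENNReal.ofReal_mul (by positivity),
    ← ENNReal.ofReal_mul (by norm_num), ← ENNReal.ofReal_add (by positivity) (by positivity)]
  apply ENNReal.ofReal_le_ofReal
  rw [← Real.sqrt_eq_rpow, ← Real.sqrt_eq_rpow]
  set D := √(∫ s in I, u₂ s ^ 2) with hD
  set A := √(∫ s in I, v s ^ 2) with hA
  -- For `N ≤ D` the interpolation term suffices alone; for `D < N` the lower-order term does.
  rcases le_or_gt N D with h | h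
  · have h14 := integral_deriv_pow_four_le hv hp hu₂ hN h
    have : √√(∫ x in I, p x ^ 4) ≤ 15 * √N * √D := by
      rw [mul_assoc, ← Real.sqrt_mul ENNReal.toReal_nonneg, Real.sqrt_le_left (by positivity),
        mul_pow, Real.sq_sqrt (by positivity)]
      have : 0 ≤ N * D := by positivity
      linarith
    have : 0 ≤ A := Real.sqrt_nonneg _
    linarith
  · obtain ⟨x₀, hx₀, hmax⟩ := isCompact_Icc.exists_isMaxOn (nonempty_Icc.2 zero_le_one) hvc.abs
    have hmaxN : |v x₀| = N := by
      refine le_antisymm (hN x₀ hx₀) ?_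
      refine ENNReal.toReal_le_of_le_ofReal (abs_nonneg _) ?_
      rw [eLpNorm_exponent_top]
      refine eLpNormEssSup_le_of_ae_bound ?_
      filter_upwards [ae_restrict_mem measurableSet_Ioo] with x hx
      exact hmax (Ioo_subset_Icc_self hx)
    have hb : ∀ x ∈ Icc (0 : ℝ) 1, |p x| ≤ 15 * A := fun x hx =>
      abs_deriv_le_l2Norm hv hp hu₂ hN h hx₀ hmaxN hx
    have hA0 : 0 ≤ A := Real.sqrt_nonneg _
    have : √√(∫ x in I, p x ^ 4) ≤ 15 * A := by
      rw [Real.sqrt_le_left (by positivity), Real.sqrt_le_left (by positivity)]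
      calc ∫ x in I, p x ^ 4 ≤ ∫ x in I, ((15 * A) ^ 2) ^ 2 := by
            refine setIntegral_mono_on
              (memLp_one_iff_integrable.1 (ContinuousOn.memLp_Ioo (hpc.pow 4) 1))
              (integrable_const _) measurableSet_Ioo fun x hx => ?_
            have := pow_le_pow_left₀ (abs_nonneg _) (hb x (Ioo_subset_Icc_self hx)) 4
            rw [Even.pow_abs (by decide)] at this
            linarith [show ((15 * A) ^ 2) ^ 2 = (15 * A) ^ 4 by ring]
        _ = _ := by simp
    have : 0 ≤ 15 * √N * √D := by positivity
    linarith

/-! ### Restricting weak derivatives to slices -/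

theorem IsTestFunction.prod {U V : Set ℝ} {φ ψ : ℝ → ℝ} (hφ : IsTestFunction U φ)
    (hψ : IsTestFunction V ψ) : IsTestFunction (U ×ˢ V) (fun p : ℝ × ℝ => φ p.1 * ψ p.2) := by
  have hsub : tsupport (fun p : ℝ × ℝ => φ p.1 * ψ p.2) ⊆ tsupport φ ×ˢ tsupport ψ := by
    refine closure_minimal (fun p hp => ?_) ((isClosed_tsupport _).prod (isClosed_tsupport _))
    exact ⟨subset_tsupport _ (left_ne_zero_of_mul hp), subset_tsupport _ (right_ne_zero_of_mul hp)⟩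
  refine ⟨(hφ.smooth.comp contDiff_fst).mul (hψ.smooth.comp contDiff_snd), ?_,
    hsub.trans (prod_mono hφ.support_subset hψ.support_subset)⟩
  exact (IsCompact.prod hφ.compact hψ.compact).of_isClosed_subset (isClosed_tsupport _) hsub

theorem fderiv_prod_mul_apply {φ ψ : ℝ → ℝ} (hφ : ContDiff ℝ ∞ φ) (hψ : ContDiff ℝ ∞ ψ)
    (p : ℝ × ℝ) :
    fderiv ℝ (fun p : ℝ × ℝ => φ p.1 * ψ p.2) p (1, 0) = deriv φ p.1 * ψ p.2 := by
  have h1 : HasFDerivAt (fun p : ℝ × ℝ => φ p.1)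
      ((fderiv ℝ φ p.1).comp (ContinuousLinearMap.fst ℝ ℝ ℝ)) p :=
    ((hφ.differentiable (by simp) p.1).hasFDerivAt).comp p hasFDerivAt_fst
  have h2 : HasFDerivAt (fun p : ℝ × ℝ => ψ p.2)
      ((fderiv ℝ ψ p.2).comp (ContinuousLinearMap.snd ℝ ℝ ℝ)) p :=
    ((hψ.differentiable (by simp) p.2).hasFDerivAt).comp p hasFDerivAt_snd
  rw [show (fun p : ℝ × ℝ => φ p.1 * ψ p.2) = (fun p => φ p.1) * fun p => ψ p.2 from rfl,
    (h1.mul h2).fderiv]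
  simp [mul_comm]

theorem volume_restrict_prod (U V : Set ℝ) :
    (volume.restrict (U ×ˢ V) : Measure (ℝ × ℝ)) =
      (volume.restrict U).prod (volume.restrict V) := by
  rw [Measure.volume_eq_prod, Measure.prod_restrict]

theorem integral_eq_integral_integral {U V : Set ℝ} {f : ℝ × ℝ → ℝ} (hf : IntegrableOn f (U ×ˢ V)) :
    ∫ p in U ×ˢ V, f p = ∫ t in V, ∫ x in U, f (x, t) := by
  rw [IntegrableOn, volume_restrict_prod] at hf
  rw [volume_restrict_prod, integral_prod_symm _ hf]

theorem ae_integrableOn_slice {U V : Set ℝ} {f : ℝ × ℝ → ℝ} (hf : IntegrableOn f (U ×ˢ V)) :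
    ∀ᵐ t ∂(volume.restrict V), IntegrableOn (fun x => f (x, t)) U := by
  rw [IntegrableOn, volume_restrict_prod] at hf
  exact hf.prod_left_ae

theorem integrableOn_integral_slice {U V : Set ℝ} {f : ℝ × ℝ → ℝ} (hf : IntegrableOn f (U ×ˢ V)) :
    IntegrableOn (fun t => ∫ x in U, f (x, t)) V := by
  rw [IntegrableOn, volume_restrict_prod] at hf
  exact hf.integral_prod_right

theorem ae_memLp_slice {U V : Set ℝ} {f : ℝ × ℝ → ℝ} (hf : MemLp f 2 (volume.restrict (U ×ˢ V))) :
    ∀ᵐ t ∂(volume.restrict V), MemLp (fun x => f (x, t)) 2 (volume.restrict U) := by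
  have h1 := ae_integrableOn_slice (f := fun p => f p ^ 2) hf.integrable_sq
  have h2 := hf.1
  rw [volume_restrict_prod] at h2
  filter_upwards [h1, h2.prodMk_right] with t ht ht2
  exact (memLp_two_iff_sq ht2).2 ht

theorem IntegrableOn.mul_of_continuous {E : Type*} [TopologicalSpace E] [MeasurableSpace E]
    [OpensMeasurableSpace E] {μ : Measure E} {U : Set E}
    {f φ : E → ℝ} (hf : IntegrableOn f U μ) (hφ : Continuous φ) {C : ℝ} (hC : ∀ x, ‖φ x‖ ≤ C) :
    IntegrableOn (fun x => f x * φ x) U μ :=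
  Integrable.mul_bdd hf (by fun_prop) (Eventually.of_forall hC)

/-- Testing with products φ(x)ψ(t) and applying Fubini, the slice identity vanishes against every
`ψ`. The exceptional null set still depends on `φ`. -/
theorem HasWeakDeriv.ae_integral_slice {a b c d : ℝ} {u g : ℝ × ℝ → ℝ}
    (h : HasWeakDeriv (Ioo a b ×ˢ Ioo c d) (1, 0) u g) (hu : IntegrableOn u (Ioo a b ×ˢ Ioo c d))
    (hg : IntegrableOn g (Ioo a b ×ˢ Ioo c d)) {φ : ℝ → ℝ} (hφ : IsTestFunction (Ioo a b) φ) :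
    ∀ᵐ t ∂(volume.restrict (Ioo c d)),
      (∫ x in Ioo a b, u (x, t) * deriv φ x) + ∫ x in Ioo a b, g (x, t) * φ x = 0 := by
  obtain ⟨C, hC⟩ := hφ.compact.exists_bound_of_continuous hφ.smooth.continuous
  have hφd : Continuous (deriv φ) := hφ.smooth.continuous_deriv (by simp)
  obtain ⟨C', hC'⟩ := hφ.compact.deriv.exists_bound_of_continuous hφd
  have i1 : IntegrableOn (fun p : ℝ × ℝ => u p * deriv φ p.1) (Ioo a b ×ˢ Ioo c d) :=
    IntegrableOn.mul_of_continuous hu (hφd.comp continuous_fst) fun p => hC' p.1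
  have i2 : IntegrableOn (fun p : ℝ × ℝ => g p * φ p.1) (Ioo a b ×ˢ Ioo c d) :=
    IntegrableOn.mul_of_continuous hg (hφ.smooth.continuous.comp continuous_fst) fun p => hC p.1
  have j1 := integrableOn_integral_slice i1
  have j2 := integrableOn_integral_slice i2
  have key := isOpen_Ioo.ae_eq_zero_of_integral_contDiff_smul_eq_zero (U := Ioo c d) (μ := volume)
    (f := fun t => (∫ x in Ioo a b, u (x, t) * deriv φ x) + ∫ x in Ioo a b, g (x, t) * φ x)
    (IntegrableOn.locallyIntegrableOn (Integrable.add j1 j2)) ?_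
  · exact (ae_restrict_iff' measurableSet_Ioo).2 key
  intro ψ hs hc hsub
  have hψ : IsTestFunction (Ioo c d) ψ := ⟨hs, hc, hsub⟩
  obtain ⟨K, hK⟩ := hc.exists_bound_of_continuous hs.continuous
  have e := h.integral_eq _ (hφ.prod hψ)
  simp only [fderiv_prod_mul_apply hφ.smooth hψ.smooth] at e
  have k1 : IntegrableOn (fun p : ℝ × ℝ => u p * (deriv φ p.1 * ψ p.2)) (Ioo a b ×ˢ Ioo c d) := by
    simpa only [mul_assoc, Function.comp_apply] using
      IntegrableOn.mul_of_continuous i1 (hs.continuous.comp continuous_snd) fun p => hK p.2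
  have k2 : IntegrableOn (fun p : ℝ × ℝ => g p * (φ p.1 * ψ p.2)) (Ioo a b ×ˢ Ioo c d) := by
    simpa only [mul_assoc, Function.comp_apply] using
      IntegrableOn.mul_of_continuous i2 (hs.continuous.comp continuous_snd) fun p => hK p.2
  rw [integral_eq_integral_integral k1, integral_eq_integral_integral k2] at e
  simp only [← mul_assoc, integral_mul_const] at e
  rw [← setIntegral_eq_integral_of_forall_compl_eq_zero (s := Ioo c d)]
  · simp only [smul_eq_mul, mul_comm (ψ _), add_mul]
    have l1 := IntegrableOn.mul_of_continuous j1 hs.continuous hK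
    have l2 := IntegrableOn.mul_of_continuous j2 hs.continuous hK
    rw [integral_add (by exact l1) (by exact l2), e, neg_add_cancel]
  · intro t ht
    rw [hψ.eq_zero_of_notMem ht, zero_smul]

/-- Integration against a fixed integrable function is continuous on `C([a, b])`. -/
theorem continuous_integral_mul_IccExtend {a b : ℝ} (hab : a ≤ b) {u : ℝ → ℝ}
    (hu : IntegrableOn u (Ioo a b)) :
    Continuous fun p : C(Icc a b, ℝ) => ∫ x in Ioo a b, u x * IccExtend hab p x := by
  have hi : ∀ p : C(Icc a b, ℝ), IntegrableOn (fun x => u x * IccExtend hab p x) (Ioo a b) :=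
    fun p => IntegrableOn.mul_of_continuous hu (p.continuous.Icc_extend' (h := hab))
      fun x => p.norm_coe_le_norm _
  refine LipschitzWith.continuous (K := (∫ x in Ioo a b, |u x|).toNNReal)
    (LipschitzWith.of_dist_le_mul fun p q => ?_)
  rw [Real.dist_eq, ← integral_sub (hi p) (hi q),
    Real.coe_toNNReal _ (integral_nonneg fun x => abs_nonneg _), ← integral_mul_const]
  rw [← Real.norm_eq_abs]
  refine norm_integral_le_of_norm_le (μ := volume.restrict (Ioo a b))
    (Integrable.mul_const (Integrable.abs hu) _) (Eventually.of_forall fun x => ?_)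
  rw [← mul_sub, norm_mul, Real.norm_eq_abs]
  gcongr
  rw [← dist_eq_norm]
  exact ContinuousMap.dist_apply_le_dist _

/-- Almost every slice of a function with a weak partial derivative is weakly differentiable. -/
theorem HasWeakDeriv.ae_slice {a b c d : ℝ} (hab : a ≤ b) {u g : ℝ × ℝ → ℝ}
    (h : HasWeakDeriv (Ioo a b ×ˢ Ioo c d) (1, 0) u g) (hu : IntegrableOn u (Ioo a b ×ˢ Ioo c d))
    (hg : IntegrableOn g (Ioo a b ×ˢ Ioo c d)) :
    ∀ᵐ t ∂(volume.restrict (Ioo c d)),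
      HasWeakDeriv (Ioo a b) 1 (fun x => u (x, t)) (fun x => g (x, t)) := by
  -- Pairs (φ, φ') lie in a separable space, so countably many test functions are C¹-dense among all
  -- of them. This gives one null set of times valid for every `φ`, since the slice identity is
  -- continuous in the pair.
  let S : Set (C(Icc a b, ℝ) × C(Icc a b, ℝ)) :=
    {P | ∃ φ, IsTestFunction (Ioo a b) φ ∧ (∀ x, P.1 x = φ x) ∧ ∀ x, P.2 x = deriv φ x}
  obtain ⟨D, hDS, hDc, hSD⟩ :=
    (TopologicalSpace.IsSeparable.of_separableSpace S).exists_countable_dense_subset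
  have hDS' : ∀ P : C(Icc a b, ℝ) × C(Icc a b, ℝ), P ∈ D → ∃ φ, IsTestFunction (Ioo a b) φ ∧
      (∀ x, P.1 x = φ x) ∧ ∀ x, P.2 x = deriv φ x := fun P hP => hDS hP
  choose! Φ hΦ using hDS'
  have hall : ∀ᵐ t ∂(volume.restrict (Ioo c d)), ∀ P ∈ D,
      (∫ x in Ioo a b, u (x, t) * deriv (Φ P) x) + ∫ x in Ioo a b, g (x, t) * Φ P x = 0 :=
    (ae_ball_iff hDc).2 fun P hP => h.ae_integral_slice hu hg (hΦ P hP).1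
  filter_upwards [hall, ae_integrableOn_slice hu, ae_integrableOn_slice hg] with t ht hut hgt
  refine ⟨hut.locallyIntegrableOn, hgt.locallyIntegrableOn, fun φ hφ => ?_⟩
  let L : C(Icc a b, ℝ) × C(Icc a b, ℝ) → ℝ := fun P =>
    (∫ x in Ioo a b, u (x, t) * IccExtend hab P.2 x) +
      ∫ x in Ioo a b, g (x, t) * IccExtend hab P.1 x
  have hL : Continuous L :=
    ((continuous_integral_mul_IccExtend hab hut).comp continuous_snd).add
      ((continuous_integral_mul_IccExtend hab hgt).comp continuous_fst)
  have hLeq : ∀ (P : C(Icc a b, ℝ) × C(Icc a b, ℝ)) (ψ : ℝ → ℝ), (∀ x, P.1 x = ψ x) →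
      (∀ x, P.2 x = deriv ψ x) →
      L P = (∫ x in Ioo a b, u (x, t) * deriv ψ x) + ∫ x in Ioo a b, g (x, t) * ψ x := by
    intro P ψ h1 h2
    refine congrArg₂ (· + ·) ?_ ?_ <;> refine setIntegral_congr_fun measurableSet_Ioo fun x hx => ?_
    · simp only [IccExtend_of_mem hab _ (Ioo_subset_Icc_self hx), h2]
    · simp only [IccExtend_of_mem hab _ (Ioo_subset_Icc_self hx), h1]
  have hclosed : IsClosed {P | L P = 0} := isClosed_eq hL continuous_const
  have hφd : Continuous (deriv φ) := hφ.smooth.continuous_deriv (by simp)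
  let P₀ : C(Icc a b, ℝ) × C(Icc a b, ℝ) :=
    (⟨fun x => φ x, hφ.smooth.continuous.comp continuous_subtype_val⟩,
      ⟨fun x => deriv φ x, hφd.comp continuous_subtype_val⟩)
  have hmem : P₀ ∈ S := ⟨φ, hφ, fun _ => rfl, fun _ => rfl⟩
  have hsub : closure D ⊆ {P | L P = 0} := by
    refine closure_minimal (fun P hP => ?_) hclosed
    rw [mem_ofPred_eq, hLeq P (Φ P) (hΦ P hP).2.1 (hΦ P hP).2.2]
    exact ht P hP
  have h0 : L P₀ = 0 := hsub (hSD hmem)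
  rw [hLeq P₀ φ (fun _ => rfl) fun _ => rfl] at h0
  simp only [fderiv_apply_one]
  linarith

/-- Exchanging coordinates makes the slicing theorem for the first variable available for the time
derivative. -/
theorem HasWeakDeriv.swap {U V : Set ℝ} {u g : ℝ × ℝ → ℝ}
    (h : HasWeakDeriv (U ×ˢ V) (0, 1) u g) (hu : IntegrableOn u (U ×ˢ V))
    (hg : IntegrableOn g (U ×ˢ V)) :
    HasWeakDeriv (V ×ˢ U) (1, 0) (u ∘ Prod.swap) (g ∘ Prod.swap) := by
  have hmp : MeasurePreserving (Prod.swap : ℝ × ℝ → ℝ × ℝ) (volume.restrict (V ×ˢ U))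
      (volume.restrict (U ×ˢ V)) := by
    rw [volume_restrict_prod, volume_restrict_prod]
    exact Measure.measurePreserving_swap
  have hme : MeasurableEmbedding (Prod.swap : ℝ × ℝ → ℝ × ℝ) :=
    MeasurableEquiv.prodComm.measurableEmbedding
  have e : ∀ f : ℝ × ℝ → ℝ, ∫ p in V ×ˢ U, f p.swap = ∫ p in U ×ˢ V, f p :=
    fun f => hmp.integral_comp hme f
  refine ⟨(show IntegrableOn _ _ _ from hmp.integrable_comp_of_integrable hu).locallyIntegrableOn,
    (show IntegrableOn _ _ _ from hmp.integrable_comp_of_integrable hg).locallyIntegrableOn,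
    fun φ hφ => ?_⟩
  have hts : tsupport (φ ∘ Prod.swap) = Prod.swap ⁻¹' tsupport φ :=
    tsupport_comp_eq_preimage φ (Homeomorph.prodComm ℝ ℝ)
  have hφ' : IsTestFunction (U ×ˢ V) (φ ∘ Prod.swap) := by
    refine ⟨hφ.smooth.comp (contDiff_snd.prodMk contDiff_fst),
      hφ.compact.comp_homeomorph (Homeomorph.prodComm ℝ ℝ), ?_⟩
    rw [hts]
    intro p hp
    have := hφ.support_subset hp
    exact ⟨this.2, this.1⟩
  have hd : ∀ p : ℝ × ℝ, fderiv ℝ (φ ∘ Prod.swap) p.swap (0, 1) = fderiv ℝ φ p (1, 0) := by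
    intro p
    have h1 : HasFDerivAt (φ ∘ Prod.swap)
        ((fderiv ℝ φ p).comp ((ContinuousLinearMap.snd ℝ ℝ ℝ).prod
          (ContinuousLinearMap.fst ℝ ℝ ℝ))) p.swap := by
      refine HasFDerivAt.comp _ ?_ (HasFDerivAt.prodMk hasFDerivAt_snd hasFDerivAt_fst)
      exact (hφ.smooth.differentiable (by simp) _).hasFDerivAt
    rw [h1.fderiv]
    simp
  have := h.integral_eq _ hφ'
  rw [← e, ← e] at this
  simpa only [hd, Function.comp, Prod.swap_swap] using this

/-! ### The dissipation estimate on a time slice -/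

section Slice

variable {u p q : ℝ → ℝ}

theorem sqrt_integral_sq_le_of_abs_le {f : ℝ → ℝ} {N : ℝ} (hN : 0 ≤ N)
    (hf : ∀ x ∈ I, |f x| ≤ N) (hfi : MemLp f 2 (volume.restrict I)) :
    √(∫ x in I, f x ^ 2) ≤ N := by
  rw [Real.sqrt_le_left hN]
  calc ∫ x in I, f x ^ 2 ≤ ∫ x in I, N ^ 2 := by
        refine setIntegral_mono_on hfi.integrable_sq (integrable_const _) measurableSet_Ioo
          fun x hx => ?_
        rw [← sq_abs]
        exact pow_le_pow_left₀ (abs_nonneg _) (hf x hx) 2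
    _ = N ^ 2 := by simp

/-- A Poincaré inequality for functions vanishing at both endpoints. -/
theorem two_mul_sqrt_integral_sq_le (hu : ACDeriv u p 0 1) (hpc : ContinuousOn p (Icc 0 1))
    (h0 : u 0 = 0) (h1 : u 1 = 0) :
    2 * √(∫ x in I, u x ^ 2) ≤ √(∫ x in I, p x ^ 2) := by
  have hp2 : MemLp p 2 (volume.restrict I) := ContinuousOn.memLp_Ioo hpc 2
  have huc : ContinuousOn u (Icc 0 1) := by simpa using hu.continuousOn
  have hpi := hu.intervalIntegrable
  -- Integrating `p` from both endpoints bounds `2|u x|` by ∫|p|; this is the source of the factor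
  -- 2.
  have hb : ∀ x ∈ I, |u x| ≤ √(∫ x in I, p x ^ 2) / 2 := by
    intro x hx
    have hxm : x ∈ uIcc (0 : ℝ) 1 := by
      rw [uIcc_of_le zero_le_one]; exact Ioo_subset_Icc_self hx
    have e0 := hu.integral_eq_sub' left_mem_uIcc hxm
    have e1 := hu.integral_eq_sub' hxm right_mem_uIcc
    have i0 := (hu.mono (uIcc_subset_uIcc left_mem_uIcc hxm)).intervalIntegrable
    have i1 := (hu.mono (uIcc_subset_uIcc hxm right_mem_uIcc)).intervalIntegrable
    have b0 := intervalIntegral.abs_integral_le_integral_abs (f := p) (μ := volume) hx.1.le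
    have b1 := intervalIntegral.abs_integral_le_integral_abs (f := p) (μ := volume) hx.2.le
    have es := intervalIntegral.integral_add_adjacent_intervals i0.abs i1.abs
    have hcs := abs_integral_mul_le (μ := volume.restrict I) (f := fun _ => (1 : ℝ))
      (g := fun x => |p x|) (memLp_const 1) hp2.abs
    simp only [one_mul, one_pow, sq_abs] at hcs
    rw [setIntegral_Ioo zero_le_one (fun x => |p x|)] at hcs
    have hone : √(∫ x in I, (1 : ℝ)) = 1 := by simp
    rw [hone, one_mul] at hcs
    have := (le_abs_self _).trans hcs
    rw [e0, h0, sub_zero] at b0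
    rw [e1, h1, zero_sub, abs_neg] at b1
    linarith
  have := sqrt_integral_sq_le_of_abs_le (by positivity) hb (ContinuousOn.memLp_Ioo huc 2)
  linarith

/-- Squaring `hG` gives X ≤ 2C₀²(ND + A²). Replacing A² by NA brings out the factor 4MC₀²N, which
smallness bounds by ρ. -/
theorem nonlinear_term_le {A D X N M C₀ ρ : ℝ} (hA0 : 0 ≤ A) (hD0 : 0 ≤ D) (hX0 : 0 ≤ X)
    (hN0 : 0 ≤ N) (hM : 0 < M) (hC₀ : 0 < C₀) (hNle : N ≤ ρ / (4 * M * C₀ ^ 2)) (hAN : A ≤ N)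
    (hG : √X ≤ C₀ * √N * √D + C₀ * A) : M * X * D ≤ ρ / 2 * (D ^ 2 + A * D) := by
  have hXle : X ≤ 2 * C₀ ^ 2 * (N * D + A ^ 2) := by
    have h2 := pow_le_pow_left₀ (Real.sqrt_nonneg _) hG 2
    rw [Real.sq_sqrt hX0] at h2
    have h3 : (C₀ * √N * √D + C₀ * A) ^ 2 ≤ 2 * ((C₀ * √N * √D) ^ 2 + (C₀ * A) ^ 2) := by
      nlinarith [sq_nonneg (C₀ * √N * √D - C₀ * A)]
    rw [mul_pow, mul_pow, mul_pow, Real.sq_sqrt hN0, Real.sq_sqrt hD0] at h3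
    linarith
  have e : 4 * M * C₀ ^ 2 * N ≤ ρ := by
    rw [le_div_iff₀ (by positivity)] at hNle
    linarith
  have h2 : A ^ 2 ≤ N * A := by nlinarith
  calc M * X * D ≤ M * (2 * C₀ ^ 2 * (N * D + N * A)) * D := by
          gcongr
          refine hXle.trans ?_
          gcongr
      _ = (4 * M * C₀ ^ 2 * N) / 2 * (D ^ 2 + A * D) := by ring
      _ ≤ _ := by gcongr

/-- The hypotheses give 4A² ≤ AD, hence 4A ≤ D, and then D(D - A)/2 ≥ 6A². -/
theorem sq_le_of_two_mul_le {A B D : ℝ} (hA0 : 0 ≤ A) (hD0 : 0 ≤ D) (hAB : 2 * A ≤ B)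
    (hBAD : B ^ 2 ≤ A * D) : A ^ 2 ≤ D ^ 2 / 2 - A * D / 2 := by
  have h4 : 4 * A ^ 2 ≤ A * D := by nlinarith
  have h5 : 4 * A ≤ D := by
    by_contra hcon
    rw [not_le] at hcon
    have : 0 < A := by linarith
    nlinarith
  nlinarith

/-- The dissipation estimate on almost every time slice. -/
theorem integral_sub_mul_flux_deriv_le {C₀ M ρ : ℝ} (hGN : IsGagliardoNirenbergConst C₀)
    {a : ℝ → ℝ} (ha : ContDiff ℝ 1 a) (hM : 0 < M) (haM : ∀ s, |deriv a s| ≤ M) (hρ : 0 < ρ)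
    (haρ : ∀ s, ρ ≤ a s) {f : ℝ → ℝ} (hu : ACDeriv u p 0 1) (hp : ACDeriv p q 0 1)
    (hq : MemLp q 2 (volume.restrict I)) (h0 : u 0 = 0) (h1 : u 1 = 0)
    (hN : eLpNorm u ∞ (volume.restrict I) ≤ ENNReal.ofReal (ρ / (4 * M * C₀ ^ 2)))
    (hf : HasWeakDeriv I 1 (fun x => a (u x) * p x) f) :
    ∫ x in I, (u x - q x) * f x ≤ -ρ * ((∫ x in I, u x ^ 2) + ∫ x in I, p x ^ 2) := by
  obtain ⟨hC₀, hGN⟩ := hGN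
  have hpc : ContinuousOn p (Icc 0 1) := by simpa using hp.continuousOn
  have huc : ContinuousOn u (Icc 0 1) := by simpa using hu.continuousOn
  have hac : ContinuousOn (fun x => a (u x)) (Icc 0 1) := ha.continuous.comp_continuousOn huc
  have hdac : ContinuousOn (fun x => deriv a (u x)) (Icc 0 1) :=
    (ha.continuous_deriv le_rfl).comp_continuousOn huc
  have hau := hu.comp_of_contDiff ha hp.continuousOn
  have hW := hau.mul hp
  -- Uniqueness of weak derivatives identifies `f` with a'(u)p² + a(u)q, allowing the pointwise
  -- expansion below.
  have hfe := HasWeakDeriv.ae_eq isOpen_Ioo hf (hW.hasWeakDeriv zero_le_one)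
  have hu2 : MemLp u 2 (volume.restrict I) := ContinuousOn.memLp_Ioo huc 2
  have hp2 : MemLp p 2 (volume.restrict I) := ContinuousOn.memLp_Ioo hpc 2
  have haq : MemLp (fun x => a (u x) * q x) 2 (volume.restrict I) :=
    hq.mul (ContinuousOn.memLp_Ioo hac ∞) (r := 2)
  have happ : MemLp (fun x => deriv a (u x) * p x * p x) 2 (volume.restrict I) :=
    ContinuousOn.memLp_Ioo ((hdac.mul hpc).mul hpc) 2
  have hF : MemLp (fun x => deriv a (u x) * p x * p x + a (u x) * q x) 2 (volume.restrict I) :=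
    happ.add haq
  set A := √(∫ x in I, u x ^ 2) with hA
  set B := √(∫ x in I, p x ^ 2) with hB
  set D := √(∫ x in I, q x ^ 2) with hD
  -- `X` is the square of the L⁴ norm of `p`.
  set X := √(∫ x in I, p x ^ 4) with hX
  have hA0 : 0 ≤ A := Real.sqrt_nonneg _
  have hB0 : 0 ≤ B := Real.sqrt_nonneg _
  have hD0 : 0 ≤ D := Real.sqrt_nonneg _
  have hX0 : 0 ≤ X := Real.sqrt_nonneg _
  have hAsq : A ^ 2 = ∫ x in I, u x ^ 2 := Real.sq_sqrt (integral_nonneg fun x => sq_nonneg _)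
  have hBsq : B ^ 2 = ∫ x in I, p x ^ 2 := Real.sq_sqrt (integral_nonneg fun x => sq_nonneg _)
  have hDsq : D ^ 2 = ∫ x in I, q x ^ 2 := Real.sq_sqrt (integral_nonneg fun x => sq_nonneg _)
  -- splitting the left-hand side
  have hsplit : ∫ x in I, (u x - q x) * f x =
      (∫ x in I, u x * (deriv a (u x) * p x * p x + a (u x) * q x)) -
        (∫ x in I, deriv a (u x) * p x * p x * q x) - ∫ x in I, a (u x) * q x * q x := by
    have i1 := integrable_mul_of_memLp_two hu2 hF
    have i2 := integrable_mul_of_memLp_two happ hq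
    rw [← integral_sub i1 i2, ← integral_sub (by exact i1.sub i2)
      (integrable_mul_of_memLp_two haq hq)]
    refine integral_congr_ae ?_
    filter_upwards [hfe] with x hx
    rw [hx]
    ring
  -- the term with `u`
  have hterm1 : ∫ x in I, u x * (deriv a (u x) * p x * p x + a (u x) * q x) ≤ -ρ * B ^ 2 := by
    have hib := hu.integral_mul_add hW
    have hi : Integrable (fun x => p x * (a (u x) * p x)) (volume.restrict I) :=
      memLp_one_iff_integrable.1 (ContinuousOn.memLp_Ioo (hpc.mul (hac.mul hpc)) 1)
    rw [h0, h1, zero_mul, zero_mul, sub_zero, ← setIntegral_Ioo zero_le_one,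
      integral_add hi (integrable_mul_of_memLp_two hu2 hF)] at hib
    have : ρ * B ^ 2 ≤ ∫ x in I, p x * (a (u x) * p x) := by
      rw [hBsq, ← integral_const_mul]
      refine integral_mono (hp2.integrable_sq.const_mul ρ) hi fun x => ?_
      have := mul_le_mul_of_nonneg_right (haρ (u x)) (sq_nonneg (p x))
      simp only
      linarith
    linarith
  have hterm3 : ρ * D ^ 2 ≤ ∫ x in I, a (u x) * q x * q x := by
    rw [hDsq, ← integral_const_mul]
    refine integral_mono (hq.integrable_sq.const_mul ρ) (integrable_mul_of_memLp_two haq hq)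
      fun x => ?_
    have := mul_le_mul_of_nonneg_right (haρ (u x)) (sq_nonneg (q x))
    simp only
    linarith
  have hterm2 : |∫ x in I, deriv a (u x) * p x * p x * q x| ≤ M * X * D := by
    refine (abs_integral_mul_le happ hq).trans ?_
    refine mul_le_mul_of_nonneg_right ?_ hD0
    rw [Real.sqrt_le_left (by positivity), mul_pow, hX,
      Real.sq_sqrt (integral_nonneg fun x => by positivity), ← integral_const_mul]
    refine integral_mono happ.integrable_sq ((memLp_one_iff_integrable.1
      (ContinuousOn.memLp_Ioo (hpc.pow 4) 1)).const_mul _) fun x => ?_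
    simp only
    calc (deriv a (u x) * p x * p x) ^ 2 = |deriv a (u x)| ^ 2 * p x ^ 4 := by
          rw [sq_abs]; ring
      _ ≤ M ^ 2 * p x ^ 4 := by
          gcongr
          exact haM _
  -- relations between the norms
  have hAB : 2 * A ≤ B := two_mul_sqrt_integral_sq_le hu hpc h0 h1
  have hBAD : B ^ 2 ≤ A * D := by
    have hib := hu.integral_mul_add hp
    have hi : Integrable (fun x => p x * p x) (volume.restrict I) :=
      integrable_mul_of_memLp_two hp2 hp2
    rw [h0, h1, zero_mul, zero_mul, sub_zero, ← setIntegral_Ioo zero_le_one,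
      integral_add hi (integrable_mul_of_memLp_two hu2 hq)] at hib
    have := (abs_le.1 (abs_integral_mul_le hu2 hq)).1
    rw [← hA, ← hD] at this
    have e : ∫ x in I, p x * p x = B ^ 2 := by
      rw [hBsq]; congr 1; ext x; ring
    rw [e] at hib
    linarith
  -- the Gagliardo–Nirenberg inequality
  have hNfin := (ContinuousOn.memLp_Ioo huc ∞).eLpNorm_ne_top
  set N := (eLpNorm u ∞ (volume.restrict I)).toReal with hNdef
  have hN0 : 0 ≤ N := ENNReal.toReal_nonneg
  have hNe : eLpNorm u ∞ (volume.restrict I) = ENNReal.ofReal N :=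
    (ENNReal.ofReal_toReal hNfin).symm
  have hNle : N ≤ ρ / (4 * M * C₀ ^ 2) := by
    rwa [hNe, ENNReal.ofReal_le_ofReal_iff (by positivity)] at hN
  have hAN : A ≤ N := sqrt_integral_sq_le_of_abs_le hN0
    (fun x hx => abs_le_eLpNorm_top one_pos huc (Ioo_subset_Icc_self hx)) hu2
  have hG := hGN u p q hu2 hp2 hq (hu.hasWeakDeriv zero_le_one) (hp.hasWeakDeriv zero_le_one)
  rw [eLpNorm_four_eq (ContinuousOn.memLp_Ioo hpc 4), eLpNorm_two_eq hq, eLpNorm_two_eq hu2, hNe,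
    ENNReal.ofReal_rpow_of_nonneg hN0 (by norm_num),
    ENNReal.ofReal_rpow_of_nonneg hD0 (by norm_num),
    ← ENNReal.ofReal_mul (by positivity), ← ENNReal.ofReal_mul (by positivity),
    ← ENNReal.ofReal_mul (by positivity), ← ENNReal.ofReal_add (by positivity) (by positivity),
    ENNReal.ofReal_le_ofReal_iff (by positivity), ← Real.sqrt_eq_rpow, ← Real.sqrt_eq_rpow]
    at hG
  have hMX : M * X * D ≤ ρ / 2 * (D ^ 2 + A * D) :=
    nonlinear_term_le hA0 hD0 hX0 hN0 hM hC₀ hNle hAN hG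
  have hAD : A ^ 2 ≤ D ^ 2 / 2 - A * D / 2 := sq_le_of_two_mul_le hA0 hD0 hAB hBAD
  -- The sum is at most -ρB² - ρ(D² - AD)/2, and `hAD` turns the second term into -ρA².
  rw [hsplit, ← hAsq, ← hBsq]
  have := (abs_le.1 hterm2).1
  have := mul_le_mul_of_nonneg_left hAD hρ.le
  linarith

end Slice

/-! ### Continuity of time translations in L² -/

section Translation

/-- Backward translation in time. -/
def timeShift (r : ℝ) : C(ℝ × ℝ, ℝ × ℝ) := ⟨fun p => (p.1, p.2 - r), by fun_prop⟩

theorem continuous_timeShift : Continuous timeShift :=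
  ContinuousMap.continuous_of_continuous_uncurry _
    (show Continuous fun x : ℝ × ℝ × ℝ => ((x.2.1, x.2.2 - x.1) : ℝ × ℝ) by fun_prop)

theorem measurePreserving_timeShift (r : ℝ) :
    MeasurePreserving (timeShift r) (volume : Measure (ℝ × ℝ)) volume :=
  (MeasurePreserving.id (volume : Measure ℝ)).prod (measurePreserving_sub_right volume r)

/-- Measure-preserving translations act strongly continuously on L², and the integral is an inner
product with the translated function. -/
theorem continuous_integral_mul_timeShift {w z : ℝ × ℝ → ℝ} (hw : MemLp w 2) (hz : MemLp z 2) :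
    Continuous fun r : ℝ => ∫ p, w p * z (p.1, p.2 - r) := by
  have h1 : Continuous fun r : ℝ =>
      Lp.compMeasurePreserving (timeShift r) (measurePreserving_timeShift r) hz.toLp :=
    continuous_const.compMeasurePreservingLp continuous_timeShift measurePreserving_timeShift
      (by norm_num)
  have h2 := Continuous.inner (𝕜 := ℝ) (continuous_const (y := hw.toLp)) h1
  convert h2 using 2 with r
  rw [L2.inner_def]
  refine integral_congr_ae ?_
  have e1 := Lp.coeFn_compMeasurePreserving hz.toLp (measurePreserving_timeShift r)
  have e2 := (measurePreserving_timeShift r).quasiMeasurePreserving.ae_eq_comp hz.coeFn_toLp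
  filter_upwards [hw.coeFn_toLp, e1, e2] with p h3 h4 h5
  rw [h3, h4, h5, real_inner_eq_re_inner ℝ]
  simp [timeShift, mul_comm]

theorem integrable_mul_timeShift {w z : ℝ × ℝ → ℝ} (hw : MemLp w 2) (hz : MemLp z 2) (h : ℝ) :
    Integrable (fun x : ℝ × (ℝ × ℝ) => w x.2 * z (x.2.1, x.2.2 - x.1))
      ((volume.restrict (Ioc 0 h)).prod volume) := by
  -- The shear (r, p) ↦ (r, p shifted by r) preserves the product measure, so both factors are in L²
  -- jointly in (r, p).
  have hT : MeasurePreserving (fun x : ℝ × (ℝ × ℝ) => (x.1, timeShift x.1 x.2))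
      ((volume.restrict (Ioc 0 h)).prod volume) ((volume.restrict (Ioc 0 h)).prod volume) := by
    refine MeasurePreserving.skew_product (MeasurePreserving.id _) ?_
      (Eventually.of_forall fun r => (measurePreserving_timeShift r).map_eq)
    exact Continuous.measurable
      (show Continuous fun x : ℝ × ℝ × ℝ => ((x.2.1, x.2.2 - x.1) : ℝ × ℝ) by fun_prop)
  exact integrable_mul_of_memLp_two (hw.comp_snd _) ((hz.comp_snd _).comp_measurePreserving hT)

theorem integral_mul_integral_timeShift {w z : ℝ × ℝ → ℝ} (hw : MemLp w 2) (hz : MemLp z 2)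
    {h : ℝ} (hh : 0 ≤ h) :
    Integrable (fun p : ℝ × ℝ => w p * ∫ r in (0 : ℝ)..h, z (p.1, p.2 - r)) ∧
    ∫ p, (w p * ∫ r in (0 : ℝ)..h, z (p.1, p.2 - r)) =
      ∫ r in (0 : ℝ)..h, ∫ p, w p * z (p.1, p.2 - r) := by
  have hi := integrable_mul_timeShift hw hz h
  simp only [intervalIntegral.integral_of_le hh, ← integral_const_mul]
  exact ⟨hi.integral_prod_right, (integral_integral_swap hi).symm⟩

end Translation

/-! ### Convexity of the energy -/

section Energy

/-- Convexity of the `H¹` energy: its increments are controlled by the first variation. -/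
theorem energy_sub_le {u p q v w : ℝ → ℝ} (hu : ACDeriv u p 0 1) (hp : ACDeriv p q 0 1)
    (hq : MemLp q 2 (volume.restrict I)) (hv : ACDeriv v w 0 1)
    (hw : MemLp w 2 (volume.restrict I)) (hu0 : u 0 = 0) (hu1 : u 1 = 0) (hv0 : v 0 = 0)
    (hv1 : v 1 = 0) :
    ((∫ x in I, u x ^ 2) + ∫ x in I, p x ^ 2) - ((∫ x in I, v x ^ 2) + ∫ x in I, w x ^ 2) ≤
      2 * ∫ x in I, (u x - q x) * (u x - v x) := by
  have hpc : ContinuousOn p (Icc 0 1) := by simpa using hp.continuousOn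
  have huc : ContinuousOn u (Icc 0 1) := by simpa using hu.continuousOn
  have hvc : ContinuousOn v (Icc 0 1) := by simpa using hv.continuousOn
  have hu2 : MemLp u 2 (volume.restrict I) := ContinuousOn.memLp_Ioo huc 2
  have hv2 : MemLp v 2 (volume.restrict I) := ContinuousOn.memLp_Ioo hvc 2
  have hp2 : MemLp p 2 (volume.restrict I) := ContinuousOn.memLp_Ioo hpc 2
  have huv : MemLp (fun x => u x - v x) 2 (volume.restrict I) := hu2.sub hv2
  have hpw : MemLp (fun x => p x - w x) 2 (volume.restrict I) := hp2.sub hw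
  -- Pointwise, 2f(f - g) - (f² - g²) = (f - g)².
  have key : ∀ {f g : ℝ → ℝ}, MemLp f 2 (volume.restrict I) → MemLp g 2 (volume.restrict I) →
      (∫ x in I, f x ^ 2) - ∫ x in I, g x ^ 2 ≤ 2 * ∫ x in I, f x * (f x - g x) := by
    intro f g hf hg
    rw [← integral_sub hf.integrable_sq hg.integrable_sq, ← integral_const_mul]
    refine integral_mono (hf.integrable_sq.sub hg.integrable_sq)
      ((integrable_mul_of_memLp_two hf (hf.sub hg)).const_mul 2) fun x => ?_
    simp only
    nlinarith [sq_nonneg (f x - g x)]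
  have k1 := key hu2 hv2
  have k2 := key hp2 hw
  -- Integration by parts moves the derivative from `u - v` onto `p`, so only `u` needs a second
  -- derivative; the boundary terms vanish.
  have hib := hp.integral_mul_add (hu.sub hv)
  rw [hu0, hu1, hv0, hv1, sub_zero, mul_zero, mul_zero, sub_zero, ← setIntegral_Ioo zero_le_one,
    integral_add (integrable_mul_of_memLp_two hq huv) (integrable_mul_of_memLp_two hp2 hpw)] at hib
  have e : ∫ x in I, (u x - q x) * (u x - v x) =
      (∫ x in I, u x * (u x - v x)) - ∫ x in I, q x * (u x - v x) := by
    rw [← integral_sub (integrable_mul_of_memLp_two hu2 huv) (integrable_mul_of_memLp_two hq huv)]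
    congr 1; ext x; ring
  rw [e]
  linarith

end Energy

/-! ### Grönwall's inequality from averaged differences -/

section Gronwall

theorem tendsto_inv_mul_integral {Ψ : ℝ → ℝ} (hΨ : Continuous Ψ) :
    Tendsto (fun h : ℝ => h⁻¹ * ∫ r in (0 : ℝ)..h, Ψ r) (𝓝[>] 0) (𝓝 (Ψ 0)) := by
  have h1 : HasDerivAt (fun h => ∫ r in (0 : ℝ)..h, Ψ r) (Ψ 0) 0 :=
    (hΨ.integral_hasStrictDerivAt 0 0).hasDerivAt
  have h2 := h1.tendsto_slope_zero_right
  simpa using h2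

theorem tendsto_inv_mul_exp_sub_one (ρ : ℝ) :
    Tendsto (fun h : ℝ => h⁻¹ * (Real.exp (2 * ρ * h) - 1)) (𝓝[>] 0) (𝓝 (2 * ρ)) := by
  have h1 : HasDerivAt (fun h : ℝ => Real.exp (2 * ρ * h)) (Real.exp (2 * ρ * 0) * (2 * ρ * 1)) 0 :=
    ((hasDerivAt_id (0 : ℝ)).const_mul (2 * ρ)).exp
  have h2 := h1.tendsto_slope_zero_right
  simpa using h2

/-- A Grönwall inequality for a function controlled through its averaged backward differences. -/
theorem eventually_integral_le_of_backward_difference {E Ψ : ℝ → ℝ} {τ ρ E₀ : ℝ} (hτ : 0 < τ)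
    (hE : IntervalIntegrable E volume 0 τ) (hnn : ∀ t, 0 ≤ E t) (hE₀ : ∀ t ≤ 0, E t = E₀)
    (hρ : 0 ≤ ρ) (hΨ : Continuous Ψ)
    (hstep : ∀ h, 0 < h → h < τ →
      ∫ t in (0 : ℝ)..τ, Real.exp (2 * ρ * t) * (E t - E (t - h)) ≤ ∫ r in (0 : ℝ)..h, Ψ r)
    (hΨ0 : Ψ 0 ≤ -(2 * ρ * ∫ t in (0 : ℝ)..τ, Real.exp (2 * ρ * t) * E t)) {ε : ℝ} (hε : 0 < ε) :
    ∀ᶠ h in 𝓝[>] (0 : ℝ), ∫ t in (τ - h)..τ, Real.exp (2 * ρ * t) * E t ≤ h * (E₀ + ε) := by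
  set H : ℝ → ℝ := fun t => Real.exp (2 * ρ * t) * E t with hH
  have hexp : Continuous fun t : ℝ => Real.exp (2 * ρ * t) := by fun_prop
  have hHi : IntervalIntegrable H volume 0 τ := hE.continuousOn_mul hexp.continuousOn
  have hE₀nn : 0 ≤ E₀ := hE₀ 0 le_rfl ▸ hnn 0
  have hHnn : ∀ t, 0 ≤ H t := fun t => mul_nonneg (Real.exp_pos _).le (hnn t)
  have hneg : ∀ h, 0 < h → IntervalIntegrable H volume (-h) 0 ∧ ∫ t in (-h)..0, H t ≤ h * E₀ := by
    intro h hh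
    have hEc : EqOn (fun t => Real.exp (2 * ρ * t) * E₀) H (uIcc (-h) 0) := by
      intro t ht
      rw [uIcc_of_le (by linarith)] at ht
      simp only [hH, hE₀ t ht.2]
    have hci : IntervalIntegrable (fun t => Real.exp (2 * ρ * t) * E₀) volume (-h) 0 :=
      (hexp.mul continuous_const).intervalIntegrable _ _
    refine ⟨hci.congr (hEc.mono uIoc_subset_uIcc), ?_⟩
    rw [← intervalIntegral.integral_congr hEc]
    calc ∫ t in (-h)..0, Real.exp (2 * ρ * t) * E₀ ≤ ∫ t in (-h)..0, E₀ := by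
          refine intervalIntegral.integral_mono_on (by linarith) hci (by simp) fun t ht => ?_
          refine mul_le_of_le_one_left hE₀nn (Real.exp_le_one_iff.2 ?_)
          exact mul_nonpos_of_nonneg_of_nonpos (by positivity) ht.2
      _ = h * E₀ := by simp
  -- Summation by parts: translating the term with `E (t - h)` leaves the strips (τ-h, τ) and (-h,
  -- 0), plus a factor e^{2ρh} - 1 from the weight.
  have hmain : ∀ h, 0 < h → h < τ → ∫ t in (τ - h)..τ, H t ≤
      h * E₀ + (Real.exp (2 * ρ * h) - 1) * (h * E₀ + ∫ t in (0 : ℝ)..τ, H t) +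
        ∫ r in (0 : ℝ)..h, Ψ r := by
    intro h hh hhτ
    obtain ⟨hni, hnle⟩ := hneg h hh
    have hm : τ - h ∈ uIcc 0 τ := by
      rw [uIcc_of_le hτ.le]; constructor <;> linarith
    have i1 : IntervalIntegrable H volume 0 (τ - h) := hHi.mono_set (uIcc_subset_uIcc_left hm)
    have i2 : IntervalIntegrable H volume (τ - h) τ := hHi.mono_set (uIcc_subset_uIcc_right hm)
    have s1 := intervalIntegral.integral_add_adjacent_intervals i1 i2
    have s2 := intervalIntegral.integral_add_adjacent_intervals hni i1
    have e1 : ∫ t in (0 : ℝ)..τ, Real.exp (2 * ρ * t) * E (t - h) =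
        Real.exp (2 * ρ * h) * ∫ t in (-h)..(τ - h), H t := by
      rw [← intervalIntegral.integral_const_mul]
      have := intervalIntegral.integral_comp_sub_right (a := 0) (b := τ)
        (fun t => Real.exp (2 * ρ * h) * H t) h
      rw [zero_sub] at this
      rw [← this]
      congr 1; ext t
      simp only [hH]
      rw [← mul_assoc, ← Real.exp_add]
      congr 2; ring
    have i3 : IntervalIntegrable (fun t => Real.exp (2 * ρ * t) * E (t - h)) volume 0 τ := by
      have : IntervalIntegrable (fun t => H (t - h)) volume (-h + h) (τ - h + h) :=
        (hni.trans i1).comp_sub_right h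
      rw [neg_add_cancel, sub_add_cancel] at this
      refine (this.const_mul (Real.exp (2 * ρ * h))).congr fun t _ => ?_
      simp only [hH]
      rw [← mul_assoc, ← Real.exp_add]
      congr 2; ring
    have hst := hstep h hh hhτ
    have e2 : ∫ t in (0 : ℝ)..τ, Real.exp (2 * ρ * t) * (E t - E (t - h)) =
        (∫ t in (0 : ℝ)..τ, H t) - Real.exp (2 * ρ * h) * ∫ t in (-h)..(τ - h), H t := by
      rw [← e1, ← intervalIntegral.integral_sub hHi i3]
      congr 1; ext t; simp only [hH]; ring
    rw [e2] at hst
    have n1 : 0 ≤ ∫ t in (τ - h)..τ, H t :=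
      intervalIntegral.integral_nonneg (by linarith) fun t _ => hHnn t
    have n2 : 0 ≤ Real.exp (2 * ρ * h) - 1 :=
      sub_nonneg.2 (Real.one_le_exp (by positivity))
    have n3 : (Real.exp (2 * ρ * h) - 1) * ∫ t in (-h)..(τ - h), H t ≤
        (Real.exp (2 * ρ * h) - 1) * (h * E₀ + ∫ t in (0 : ℝ)..τ, H t) := by
      refine mul_le_mul_of_nonneg_left ?_ n2
      linarith
    linarith
  have hid : Tendsto (fun h : ℝ => h) (𝓝[>] 0) (𝓝 0) := tendsto_id.mono_left nhdsWithin_le_nhds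
  -- The limit is E₀ + 2ρ∫H + Ψ(0), and `hΨ0` is exactly what makes it at most E₀.
  have hlim : Tendsto (fun h : ℝ => E₀ + h⁻¹ * (Real.exp (2 * ρ * h) - 1) *
      (h * E₀ + ∫ t in (0 : ℝ)..τ, H t) + h⁻¹ * ∫ r in (0 : ℝ)..h, Ψ r) (𝓝[>] 0)
      (𝓝 (E₀ + 2 * ρ * (0 * E₀ + ∫ t in (0 : ℝ)..τ, H t) + Ψ 0)) :=
    (((tendsto_inv_mul_exp_sub_one ρ).mul ((hid.mul_const E₀).add_const _)).const_add E₀).add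
      (tendsto_inv_mul_integral hΨ)
  have hlt : E₀ + 2 * ρ * (0 * E₀ + ∫ t in (0 : ℝ)..τ, H t) + Ψ 0 < E₀ + ε := by
    rw [zero_mul, zero_add]; linarith
  filter_upwards [hlim.eventually (gt_mem_nhds hlt), self_mem_nhdsWithin,
    Ioo_mem_nhdsGT hτ] with h hb hh0 hhτ
  rw [mem_Ioi] at hh0
  have := mul_le_mul_of_nonneg_left hb.le hh0.le
  have hc : h * (E₀ + h⁻¹ * (Real.exp (2 * ρ * h) - 1) *
      (h * E₀ + ∫ t in (0 : ℝ)..τ, H t) + h⁻¹ * ∫ r in (0 : ℝ)..h, Ψ r) =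
      h * E₀ + (Real.exp (2 * ρ * h) - 1) * (h * E₀ + ∫ t in (0 : ℝ)..τ, H t) +
        ∫ r in (0 : ℝ)..h, Ψ r := by
    field_simp
  rw [hc] at this
  exact (hmain h hh0 hhτ.2).trans this

end Gronwall

/-! ### Weak compactness and lower semicontinuity in H¹ -/

theorem weakDeriv_ae_eq {u g : ℝ → ℝ} (h : HasWeakDeriv I 1 u g) :
    weakDeriv I 1 u =ᵐ[volume.restrict I] g := by
  have hex : ∃ g, HasWeakDeriv I 1 u g := ⟨g, h⟩
  rw [weakDeriv, dif_pos hex]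
  exact HasWeakDeriv.ae_eq isOpen_Ioo hex.choose_spec h

theorem h1Norm_eq {u g : ℝ → ℝ} (h : HasWeakDeriv I 1 u g) :
    h1Norm u = √((∫ x in I, u x ^ 2) + ∫ x in I, g x ^ 2) := by
  have e : ∫ x in I, weakDeriv I 1 u x ^ 2 = ∫ x in I, g x ^ 2 := by
    refine integral_congr_ae ?_
    filter_upwards [weakDeriv_ae_eq h] with x hx
    rw [hx]
  rw [h1Norm, e]

theorem ACDeriv.of_hasWeakDeriv {u g : ℝ → ℝ} {a b : ℝ} (hab : a < b)
    (hu : ContinuousOn u (Icc a b)) (h : HasWeakDeriv (Ioo a b) 1 u g)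
    (hg : IntegrableOn g (Ioo a b)) : ACDeriv u g a b := by
  obtain ⟨v, hv, hve⟩ := h.exists_acDeriv hab
    (memLp_one_iff_integrable.1 (ContinuousOn.memLp_Ioo hu 1)) hg
  have hvc := hv.continuousOn
  rw [uIcc_of_le hab.le] at hvc
  rw [restrict_Ioo_eq_restrict_Icc] at hve
  have := Measure.eqOn_Icc_of_ae_eq volume hab.ne hve hu hvc
  exact hv.congr hab.le (by rwa [uIcc_of_le hab.le]) (Eventually.of_forall fun x _ => rfl)

/-- Weak closedness of balls in `H¹`. -/
theorem exists_hasWeakDeriv_of_tendsto {u : ℝ → ℝ} {U G : ℕ → ℝ → ℝ} {R : ℝ}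
    (hu : LocallyIntegrableOn u I) (hU : ∀ n, HasWeakDeriv I 1 (U n) (G n))
    (hG : ∀ n, MemLp (G n) 2 (volume.restrict I)) (hR : ∀ n, ∫ x in I, G n x ^ 2 ≤ R)
    (hlim : ∀ φ, IsTestFunction I φ → Tendsto (fun n => ∫ x in I, U n x * deriv φ x) atTop
      (𝓝 (∫ x in I, u x * deriv φ x))) :
    ∃ g, HasWeakDeriv I 1 u g ∧ MemLp g 2 (volume.restrict I) ∧ ∫ x in I, g x ^ 2 ≤ R := by
  have hR0 : 0 ≤ R := (integral_nonneg fun x => sq_nonneg _).trans (hR 0)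
  have hinner : ∀ f g : Lp ℝ 2 (volume.restrict I), inner ℝ f g = ∫ x in I, f x * g x := by
    intro f g
    rw [L2.inner_def]
    congr 1; ext x
    simp [mul_comm]
  have hnorm : ∀ f : Lp ℝ 2 (volume.restrict I), ‖f‖ ^ 2 = ∫ x in I, f x ^ 2 := by
    intro f
    rw [← real_inner_self_eq_norm_sq, hinner]
    congr 1; ext x; ring
  let X : ℕ → WeakDual ℝ (Lp ℝ 2 (volume.restrict I)) := fun n =>
    StrongDual.toWeakDual (InnerProductSpace.toDual ℝ _ (hG n).toLp)
  have hXmem : ∀ n, X n ∈ WeakDual.toStrongDual ⁻¹'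
      Metric.closedBall (0 : StrongDual ℝ (Lp ℝ 2 (volume.restrict I))) √R := by
    intro n
    rw [mem_preimage, mem_closedBall_zero_iff]
    change ‖InnerProductSpace.toDual ℝ _ (hG n).toLp‖ ≤ √R
    rw [LinearIsometryEquiv.norm_map]
    apply Real.le_sqrt_of_sq_le
    rw [hnorm]
    refine le_trans (le_of_eq (integral_congr_ae ?_)) (hR n)
    filter_upwards [(hG n).coeFn_toLp] with x hx
    rw [hx]
  -- Banach–Alaoglu in the dual of L²; a cluster point is enough, without extracting a subsequence.
  obtain ⟨ℓ, hℓ, hcl⟩ := (WeakDual.isCompact_closedBall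
    (0 : StrongDual ℝ (Lp ℝ 2 (volume.restrict I))) √R).exists_mapClusterPt
      (f := atTop) (u := X) (tendsto_principal.2 (Eventually.of_forall hXmem))
  rw [mem_preimage, mem_closedBall_zero_iff] at hℓ
  set g : Lp ℝ 2 (volume.restrict I) :=
    (InnerProductSpace.toDual ℝ _).symm (WeakDual.toStrongDual ℓ) with hg
  have hgm : MemLp g 2 (volume.restrict I) := Lp.memLp g
  refine ⟨g, ⟨hu, ?_, fun φ hφ => ?_⟩, hgm, ?_⟩
  · exact IntegrableOn.locallyIntegrableOn (hgm.integrable (by norm_num))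
  · have hφm : MemLp φ 2 (volume.restrict I) :=
      ContinuousOn.memLp_Ioo hφ.smooth.continuous.continuousOn 2
    have h1 : MapClusterPt (ℓ hφm.toLp) atTop fun n => X n hφm.toLp :=
      hcl.continuousAt_comp (WeakDual.eval_continuous hφm.toLp).continuousAt
    have h2 : ∀ n, X n hφm.toLp = -∫ x in I, U n x * deriv φ x := by
      intro n
      change inner ℝ (hG n).toLp hφm.toLp = _
      have := (hU n).integral_eq φ hφ
      simp only [fderiv_apply_one] at this
      rw [this, neg_neg, hinner]
      refine integral_congr_ae ?_
      filter_upwards [(hG n).coeFn_toLp, hφm.coeFn_toLp] with x hx1 hx2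
      rw [hx1, hx2]
    simp only [h2] at h1
    -- The pairings converge by `hlim`, so their cluster value must be the limit.
    have h3 : ℓ hφm.toLp = -∫ x in I, u x * deriv φ x := by
      have hne : (𝓝 (ℓ hφm.toLp) ⊓ 𝓝 (-∫ x in I, u x * deriv φ x)).NeBot :=
        NeBot.mono h1 (inf_le_inf_left _ (hlim φ hφ).neg)
      exact eq_of_nhds_neBot hne
    have h4 : ℓ hφm.toLp = ∫ x in I, g x * φ x := by
      have : inner ℝ g hφm.toLp = ℓ hφm.toLp := by
        rw [hg, InnerProductSpace.toDual_symm_apply]; rfl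
      rw [← this, hinner]
      refine integral_congr_ae ?_
      filter_upwards [hφm.coeFn_toLp] with x hx
      rw [hx]
    simp only [fderiv_apply_one]
    rw [← h4, h3, neg_neg]
  · rw [← hnorm, hg, LinearIsometryEquiv.norm_map]
    calc _ ≤ √R ^ 2 := by gcongr
      _ = R := Real.sq_sqrt hR0

section Rectangle

variable {T : ℝ} {y : ℝ × ℝ → ℝ}

theorem ContinuousOn.slice_left (hy : ContinuousOn y (Icc 0 1 ×ˢ Icc 0 T)) {t : ℝ}
    (ht : t ∈ Icc 0 T) : ContinuousOn (fun x => y (x, t)) (Icc 0 1) :=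
  hy.comp (by fun_prop) fun _ hx => ⟨hx, ht⟩

theorem ContinuousOn.slice_right (hy : ContinuousOn y (Icc 0 1 ×ˢ Icc 0 T)) {x : ℝ}
    (hx : x ∈ Icc (0 : ℝ) 1) : ContinuousOn (fun t => y (x, t)) (Icc 0 T) :=
  hy.comp (by fun_prop) fun _ ht => ⟨hx, ht⟩

theorem tendsto_integral_slice (hy : ContinuousOn y (Icc 0 1 ×ˢ Icc 0 T)) {t : ℝ} {s : ℕ → ℝ}
    (ht : t ∈ Icc 0 T) (hs : ∀ n, s n ∈ Icc 0 T) (hlim : Tendsto s atTop (𝓝 t))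
    {F : ℝ → ℝ} (hF : Continuous F) {φ : ℝ → ℝ} (hφ : Continuous φ) :
    Tendsto (fun n => ∫ x in I, F (y (x, s n)) * φ x) atTop (𝓝 (∫ x in I, F (y (x, t)) * φ x)) := by
  have hK : IsCompact (Icc (0 : ℝ) 1 ×ˢ Icc 0 T) := isCompact_Icc.prod isCompact_Icc
  have hg : ContinuousOn (fun p : ℝ × ℝ => F (y p) * φ p.1) (Icc 0 1 ×ˢ Icc 0 T) :=
    (hF.comp_continuousOn hy).mul (by fun_prop)
  obtain ⟨C, hC⟩ := hK.exists_bound_of_continuousOn hg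
  refine tendsto_integral_of_dominated_convergence (fun _ => C) (fun n => ?_) (by simp)
    (fun n => ?_) ?_
  · exact ((ContinuousOn.slice_left hg (hs n)).mono Ioo_subset_Icc_self).aestronglyMeasurable
      measurableSet_Ioo
  · filter_upwards [ae_restrict_mem measurableSet_Ioo] with x hx
    exact hC (x, s n) ⟨Ioo_subset_Icc_self hx, hs n⟩
  · filter_upwards [ae_restrict_mem measurableSet_Ioo] with x hx
    have h1 := ContinuousOn.slice_right hg (Ioo_subset_Icc_self hx) t ht
    exact h1.tendsto.comp (tendsto_nhdsWithin_iff.2 ⟨hlim, Eventually.of_forall hs⟩)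

/-- Lower semicontinuity in time of the `H¹` energy of a continuous function. -/
theorem exists_hasWeakDeriv_slice (hy : ContinuousOn y (Icc 0 1 ×ˢ Icc 0 T)) {t : ℝ}
    (ht : t ∈ Icc 0 T) {B : ℝ}
    (h : ∀ ε > 0, ∀ δ > 0, ∃ s ∈ Icc 0 T, |s - t| < δ ∧ ∃ g,
      HasWeakDeriv I 1 (fun x => y (x, s)) g ∧ MemLp g 2 (volume.restrict I) ∧
      (∫ x in I, y (x, s) ^ 2) + ∫ x in I, g x ^ 2 ≤ B + ε) :
    ∃ g, HasWeakDeriv I 1 (fun x => y (x, t)) g ∧ MemLp g 2 (volume.restrict I) ∧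
      (∫ x in I, y (x, t) ^ 2) + ∫ x in I, g x ^ 2 ≤ B := by
  have hyt : MemLp (fun x => y (x, t)) 2 (volume.restrict I) :=
    ContinuousOn.memLp_Ioo (ContinuousOn.slice_left hy ht) 2
  have key : ∀ ε > 0, ∃ g, HasWeakDeriv I 1 (fun x => y (x, t)) g ∧
      MemLp g 2 (volume.restrict I) ∧ ∫ x in I, g x ^ 2 ≤ B - (∫ x in I, y (x, t) ^ 2) + ε := by
    intro ε hε
    choose s hs hst g hg hgm hb using fun n : ℕ => h (ε / 2) (by positivity) (1 / ((n : ℝ) + 1))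
      (by positivity)
    have hlim : Tendsto s atTop (𝓝 t) := by
      rw [tendsto_iff_dist_tendsto_zero]
      exact squeeze_zero (fun n => dist_nonneg) (fun n => (hst n).le)
        tendsto_one_div_add_atTop_nhds_zero_nat
    have hsq := tendsto_integral_slice hy ht hs hlim (F := fun r => r ^ 2) (by fun_prop)
      (φ := fun _ => 1) (by fun_prop)
    simp only [mul_one] at hsq
    -- The L² part of the energy converges, so eventually its lower bound leaves a bound on the
    -- derivative part alone.
    obtain ⟨n₀, hn₀⟩ := eventually_atTop.1
      (hsq.eventually (lt_mem_nhds (show (∫ x in I, y (x, t) ^ 2) - ε / 2 < _ by linarith)))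
    refine exists_hasWeakDeriv_of_tendsto (U := fun n x => y (x, s (n + n₀)))
      (G := fun n => g (n + n₀))
      (IntegrableOn.locallyIntegrableOn (hyt.integrable (by norm_num)))
      (fun n => hg _) (fun n => hgm _) (fun n => ?_) fun φ hφ => ?_
    · have := hn₀ (n + n₀) (by omega)
      have := hb (n + n₀)
      linarith
    · exact (tendsto_add_atTop_iff_nat n₀).2 (tendsto_integral_slice hy ht hs hlim continuous_id
        (hφ.smooth.continuous_deriv (by simp)))
  obtain ⟨g, hg, hgm, -⟩ := key 1 one_pos
  refine ⟨g, hg, hgm, le_of_forall_pos_le_add fun ε hε => ?_⟩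
  -- The weak derivative obtained depends on ε only up to null sets, so ε can tend to zero with `g`
  -- fixed.
  obtain ⟨g', hg', -, hb⟩ := key ε hε
  have e : ∫ x in I, g' x ^ 2 = ∫ x in I, g x ^ 2 := by
    refine integral_congr_ae ?_
    filter_upwards [HasWeakDeriv.ae_eq isOpen_Ioo hg' hg] with x hx
    rw [hx]
  linarith

end Rectangle

/-! ### Regular time slices of a solution -/

/-- The time slice at `t` of a solution, in terms of the continuous representative `p` of
`y_x(·, t)`. -/
structure RegularSlice (a : ℝ → ℝ) (y yx yxx yt : ℝ × ℝ → ℝ) (t : ℝ) (p : ℝ → ℝ) : Prop where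
  acDeriv : ACDeriv (fun x => y (x, t)) p 0 1
  acDeriv_x : ACDeriv p (fun x => yxx (x, t)) 0 1
  ae_eq : (fun x => yx (x, t)) =ᵐ[volume.restrict I] p
  memLp_xx : MemLp (fun x => yxx (x, t)) 2 (volume.restrict I)
  flux : HasWeakDeriv I 1 (fun x => a (y (x, t)) * p x) (fun x => yt (x, t))

section Solution

variable {a : ℝ → ℝ} {T : ℝ} {y yx yxx yt : ℝ × ℝ → ℝ}

theorem measurableSet_Q (T : ℝ) : MeasurableSet (Q T) := measurableSet_Ioo.prod measurableSet_Ioo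

theorem Q_subset (T : ℝ) : Q T ⊆ Icc 0 1 ×ˢ Icc 0 T :=
  prod_mono Ioo_subset_Icc_self Ioo_subset_Icc_self

theorem integrableOn_Q_of_memLp {f : ℝ × ℝ → ℝ} (hf : MemLp f 2 (volume.restrict (Q T))) :
    IntegrableOn f (Q T) := by
  have : IsFiniteMeasure ((volume : Measure (ℝ × ℝ)).restrict (Q T)) := by
    rw [volume_restrict_prod]; infer_instance
  exact hf.integrable (by norm_num)

theorem ae_regularSlice (hy : ContinuousOn y (Icc 0 1 ×ˢ Icc 0 T)) (hW : IsW212 T y yx yxx yt)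
    (hflux : HasWeakDeriv (Q T) (1, 0) (fun p => a (y p) * yx p) yt) (ha : Continuous a)
    {K : ℝ} (hK : ∀ s, ‖a s‖ ≤ K) :
    ∀ᵐ t ∂(volume.restrict (Ioo 0 T)), ∃ p, RegularSlice a y yx yxx yt t p := by
  -- Boundedness of `a` makes the flux integrable, as slicing its weak derivative requires.
  have hay : IntegrableOn (fun p => a (y p) * yx p) (Q T) :=
    Integrable.bdd_mul (integrableOn_Q_of_memLp hW.memLp_x)
      (((ha.comp_continuousOn hy).mono (Q_subset T)).aestronglyMeasurable (measurableSet_Q T))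
      (Eventually.of_forall fun p => hK _)
  filter_upwards [hW.deriv_x.ae_slice zero_le_one (integrableOn_Q_of_memLp hW.memLp)
      (integrableOn_Q_of_memLp hW.memLp_x),
    hW.deriv_xx.ae_slice zero_le_one (integrableOn_Q_of_memLp hW.memLp_x)
      (integrableOn_Q_of_memLp hW.memLp_xx),
    hflux.ae_slice zero_le_one hay (integrableOn_Q_of_memLp hW.memLp_t),
    ae_memLp_slice hW.memLp_x, ae_memLp_slice hW.memLp_xx, ae_restrict_mem measurableSet_Ioo]
    with t h1 h2 h3 hx hxx ht
  obtain ⟨p, hp, hpe⟩ := exists_acDeriv_of_memLp one_pos h2 hx hxx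
  have hyt := ContinuousOn.slice_left hy (Ioo_subset_Icc_self ht)
  refine ⟨p, ?_, hp, hpe, hxx, h3.congr ?_ (ae_eq_refl _)⟩
  · exact ACDeriv.of_hasWeakDeriv one_pos hyt (h1.congr (ae_eq_refl _) hpe)
      ((hx.integrable (by norm_num)).congr hpe)
  · filter_upwards [hpe] with x hx
    rw [hx]

theorem ae_acDeriv_time (hT : 0 < T) (hy : ContinuousOn y (Icc 0 1 ×ˢ Icc 0 T))
    (hW : IsW212 T y yx yxx yt) :
    ∀ᵐ x ∂(volume.restrict I), ACDeriv (fun t => y (x, t)) (fun t => yt (x, t)) 0 T := by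
  have hi := integrableOn_Q_of_memLp hW.memLp_t
  have hs := hW.deriv_t.swap (integrableOn_Q_of_memLp hW.memLp) hi
  have hmp : MeasurePreserving (Prod.swap : ℝ × ℝ → ℝ × ℝ) (volume.restrict (Ioo 0 T ×ˢ Ioo 0 1))
      (volume.restrict (Q T)) := by
    rw [volume_restrict_prod, volume_restrict_prod]
    exact Measure.measurePreserving_swap
  have h1 : IntegrableOn (y ∘ Prod.swap) (Ioo 0 T ×ˢ Ioo 0 1) :=
    hmp.integrable_comp_of_integrable (integrableOn_Q_of_memLp hW.memLp)
  have h2 : IntegrableOn (yt ∘ Prod.swap) (Ioo 0 T ×ˢ Ioo 0 1) :=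
    hmp.integrable_comp_of_integrable hi
  filter_upwards [hs.ae_slice hT.le h1 h2, ae_integrableOn_slice h2,
    ae_restrict_mem measurableSet_Ioo] with x hx hxi hxm
  exact ACDeriv.of_hasWeakDeriv hT (ContinuousOn.slice_right hy (Ioo_subset_Icc_self hxm)) hx hxi

/-- Extending the derivative by zero freezes `f` at `f 0` for negative times, which explains `max (t
- h) 0` and matches the constant extension of the energy. -/
theorem ACDeriv.integral_indicator_sub {f g : ℝ → ℝ} (hf : ACDeriv f g 0 T) {t h : ℝ}
    (ht : t ∈ Ioo 0 T) (hh : 0 < h) :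
    ∫ r in (0 : ℝ)..h, (Ioo 0 T).indicator g (t - r) = f t - f (max (t - h) 0) := by
  have hT : 0 ≤ T := (ht.1.trans ht.2).le
  rw [intervalIntegral.integral_comp_sub_left (fun s => (Ioo 0 T).indicator g s), sub_zero]
  have hpos : ∀ s, 0 ≤ s → s ≤ t →
      ∫ r in s..t, (Ioo 0 T).indicator g r = f t - f s ∧
        IntervalIntegrable ((Ioo 0 T).indicator g) volume s t := by
    intro s hs0 hst
    have hs : s ∈ uIcc 0 T := by rw [uIcc_of_le hT]; exact ⟨hs0, hst.trans ht.2.le⟩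
    have ht' : t ∈ uIcc 0 T := by rw [uIcc_of_le hT]; exact Ioo_subset_Icc_self ht
    have he : EqOn g ((Ioo 0 T).indicator g) (uIoc s t) := by
      intro r hr
      rw [uIoc_of_le hst] at hr
      rw [indicator_of_mem]
      exact ⟨hs0.trans_lt hr.1, hr.2.trans_lt ht.2⟩
    have hi := (hf.mono (uIcc_subset_uIcc hs ht')).intervalIntegrable
    refine ⟨?_, hi.congr he⟩
    rw [← hf.integral_eq_sub' hs ht']
    exact intervalIntegral.integral_congr_ae (Eventually.of_forall fun r hr => (he hr).symm)
  rcases le_total 0 (t - h) with h0 | h0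
  · rw [max_eq_left h0]
    exact (hpos (t - h) h0 (by linarith)).1
  · have hz : EqOn (fun _ => (0 : ℝ)) ((Ioo 0 T).indicator g) (uIcc (t - h) 0) := by
      intro r hr
      rw [uIcc_of_le h0] at hr
      rw [indicator_of_notMem]
      exact fun h' => absurd h'.1 (not_lt.2 hr.2)
    obtain ⟨e, hi⟩ := hpos 0 le_rfl ht.1.le
    have hi0 : IntervalIntegrable ((Ioo 0 T).indicator g) volume (t - h) 0 :=
      (intervalIntegrable_const (c := (0 : ℝ))).congr (hz.mono uIoc_subset_uIcc)
    rw [max_eq_right h0, ← intervalIntegral.integral_add_adjacent_intervals hi0 hi,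
      ← intervalIntegral.integral_congr hz, e]
    simp

theorem boundary_at_zero (hT : 0 < T) (hy : ContinuousOn y (Icc 0 1 ×ˢ Icc 0 T)) {x : ℝ}
    (hx : x ∈ Icc (0 : ℝ) 1) (hb : ∀ t ∈ Ioo 0 T, y (x, t) = 0) : y (x, 0) = 0 := by
  have h := ContinuousOn.slice_right hy hx
  have : EqOn (fun t => y (x, t)) (fun _ => 0) (closure (Ioo 0 T)) := by
    refine EqOn.of_subset_closure (s := Ioo 0 T) (fun t ht => hb t ht) ?_ continuousOn_const
      subset_closure subset_rfl
    rwa [closure_Ioo hT.ne]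
  exact this (by rw [closure_Ioo hT.ne]; exact left_mem_Icc.2 hT.le)

/-- The `H¹` energy at time `t`, extended by `E₀` to nonpositive times. -/
noncomputable def energy (y yx : ℝ × ℝ → ℝ) (E₀ t : ℝ) : ℝ :=
  if t ≤ 0 then E₀ else (∫ x in I, y (x, t) ^ 2) + ∫ x in I, yx (x, t) ^ 2

theorem energy_nonneg {E₀ : ℝ} (h : 0 ≤ E₀) (t : ℝ) : 0 ≤ energy y yx E₀ t := by
  rw [energy]
  split_ifs
  · exact h
  · exact add_nonneg (integral_nonneg fun x => sq_nonneg _) (integral_nonneg fun x => sq_nonneg _)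

theorem RegularSlice.energy_eq {t : ℝ} {p : ℝ → ℝ} (h : RegularSlice a y yx yxx yt t p) (ht : 0 < t)
    (E₀ : ℝ) : energy y yx E₀ t = (∫ x in I, y (x, t) ^ 2) + ∫ x in I, p x ^ 2 := by
  rw [energy, if_neg (not_le.2 ht)]
  congr 1
  refine integral_congr_ae ?_
  filter_upwards [h.ae_eq] with x hx
  rw [hx]

theorem RegularSlice.memLp {t : ℝ} {p : ℝ → ℝ} (h : RegularSlice a y yx yxx yt t p) :
    MemLp p 2 (volume.restrict I) :=
  ContinuousOn.memLp_Ioo (by simpa using h.acDeriv_x.continuousOn) 2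

theorem intervalIntegrable_energy (hT : 0 < T) (hW : IsW212 T y yx yxx yt) (E₀ : ℝ) :
    IntervalIntegrable (energy y yx E₀) volume 0 T := by
  rw [intervalIntegrable_iff_Ioo hT.le]
  have h1 := integrableOn_integral_slice (f := fun p => y p ^ 2) hW.memLp.integrable_sq
  have h2 := integrableOn_integral_slice (f := fun p => yx p ^ 2) hW.memLp_x.integrable_sq
  refine (Integrable.add h1 h2 : Integrable _ _).congr ?_
  filter_upwards [ae_restrict_mem measurableSet_Ioo] with t ht
  simp [energy, not_le.2 ht.1]

end Solution

/-! ### The backward-difference inequality and decay -/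

theorem integral_indicator_mul_eq {U V : Set ℝ} (hU : MeasurableSet U) (hV : MeasurableSet V)
    {f F : ℝ × ℝ → ℝ} (hi : Integrable (fun p => (U ×ˢ V).indicator f p * F p)) :
    IntegrableOn (fun t => ∫ x in U, f (x, t) * F (x, t)) V ∧
    ∫ p, (U ×ˢ V).indicator f p * F p = ∫ t in V, ∫ x in U, f (x, t) * F (x, t) := by
  have e : (fun p => (U ×ˢ V).indicator f p * F p) = (U ×ˢ V).indicator fun p => f p * F p := by
    ext p; exact (indicator_mul_left _ _ _).symm
  rw [e, integrable_indicator_iff (hU.prod hV)] at hi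
  rw [e, integral_indicator (hU.prod hV), integral_eq_integral_integral hi]
  exact ⟨integrableOn_integral_slice hi, rfl⟩

section Decay

variable {a : ℝ → ℝ} {T : ℝ} {y yx yxx yt : ℝ × ℝ → ℝ}

theorem memLp_weight (hW : IsW212 T y yx yxx yt) {τ : ℝ} (hτ : τ ≤ T) (ρ : ℝ) :
    MemLp ((I ×ˢ Ioo 0 τ).indicator fun p => 2 * Real.exp (2 * ρ * p.2) * (y p - yxx p)) 2 := by
  have hms : MeasurableSet (I ×ˢ Ioo 0 τ) := measurableSet_Ioo.prod measurableSet_Ioo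
  rw [memLp_indicator_iff_restrict hms]
  have h1 : MemLp (fun p => y p - yxx p) 2 (volume.restrict (I ×ˢ Ioo 0 τ)) :=
    (hW.memLp.sub hW.memLp_xx).mono_measure
      (Measure.restrict_mono (prod_mono subset_rfl (Ioo_subset_Ioo_right hτ)) le_rfl)
  have hc : Continuous fun p : ℝ × ℝ => 2 * Real.exp (2 * ρ * p.2) := by fun_prop
  obtain ⟨C, hC⟩ := (isCompact_Icc.prod isCompact_Icc :
    IsCompact (Icc (0 : ℝ) 1 ×ˢ Icc 0 τ)).exists_bound_of_continuousOn hc.continuousOn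
  have h2 : MemLp (fun p : ℝ × ℝ => 2 * Real.exp (2 * ρ * p.2)) ∞
      (volume.restrict (I ×ˢ Ioo 0 τ)) := by
    refine memLp_top_of_bound hc.aestronglyMeasurable C ?_
    filter_upwards [ae_restrict_mem hms] with p hp
    exact hC p ⟨Ioo_subset_Icc_self hp.1, Ioo_subset_Icc_self hp.2⟩
  exact h1.mul h2 (r := 2)

/-- Convexity of the energy is applied slice by slice and integrated in `t`; writing the increment
of `y` as an integral of translated `yt`, Fubini then pulls the integral over `r` outside. -/
theorem integral_backward_difference_le (hT : 0 < T) (hy : ContinuousOn y (Icc 0 1 ×ˢ Icc 0 T))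
    (hW : IsW212 T y yx yxx yt) (hb : ∀ t ∈ Ioo 0 T, y (0, t) = 0 ∧ y (1, t) = 0)
    (hreg : ∀ᵐ t ∂(volume.restrict (Ioo 0 T)), ∃ p, RegularSlice a y yx yxx yt t p)
    {w₀ : ℝ → ℝ} (hw₀ : ACDeriv (fun x => y (x, 0)) w₀ 0 1) (hw₀m : MemLp w₀ 2 (volume.restrict I))
    {E₀ : ℝ} (hE₀ : E₀ = (∫ x in I, y (x, 0) ^ 2) + ∫ x in I, w₀ x ^ 2) {τ ρ : ℝ}
    (hτ : τ ≤ T) {h : ℝ} (hh : 0 < h) (hhτ : h < τ) :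
    ∫ t in (0 : ℝ)..τ, Real.exp (2 * ρ * t) * (energy y yx E₀ t - energy y yx E₀ (t - h)) ≤
      ∫ r in (0 : ℝ)..h, ∫ p, (I ×ˢ Ioo 0 τ).indicator
        (fun p => 2 * Real.exp (2 * ρ * p.2) * (y p - yxx p)) p *
          (Q T).indicator yt (p.1, p.2 - r) := by
  have hτ0 : 0 < τ := hh.trans hhτ
  have hw := memLp_weight hW hτ ρ
  have hz : MemLp ((Q T).indicator yt) 2 := (memLp_indicator_iff_restrict (measurableSet_Q T)).2
    hW.memLp_t
  obtain ⟨hi, he⟩ := integral_mul_integral_timeShift hw hz hh.le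
  obtain ⟨hi', he'⟩ := integral_indicator_mul_eq measurableSet_Ioo measurableSet_Ioo hi
  rw [← he, he', ← setIntegral_Ioo hτ0.le]
  have hEi := intervalIntegrable_energy hT hW E₀
  have hEi0 : IntervalIntegrable (energy y yx E₀) volume 0 τ :=
    hEi.mono_set (uIcc_subset_uIcc_left (by rw [uIcc_of_le hT.le]; exact ⟨hτ0.le, hτ⟩))
  have hEi1 : IntervalIntegrable (energy y yx E₀) volume (0 - h) (τ - h) := by
    have h1 : IntervalIntegrable (energy y yx E₀) volume (0 - h) 0 := by
      refine (intervalIntegrable_const (c := E₀)).congr fun t ht => ?_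
      rw [uIoc_of_le (by linarith)] at ht
      exact (if_pos ht.2).symm
    exact h1.trans (hEi0.mono_set (uIcc_subset_uIcc_left
      (by rw [uIcc_of_le hτ0.le]; constructor <;> linarith)))
  have hEi2 : IntervalIntegrable (fun t => energy y yx E₀ (t - h)) volume 0 τ := by
    simpa using hEi1.comp_sub_right h
  have hlhs : IntegrableOn (fun t => Real.exp (2 * ρ * t) *
      (energy y yx E₀ t - energy y yx E₀ (t - h))) (Ioo 0 τ) := by
    rw [← intervalIntegrable_iff_Ioo hτ0.le]
    exact (hEi0.sub hEi2).continuousOn_mul (by fun_prop)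
  have hreg' : ∀ᵐ t ∂(volume : Measure ℝ), t ∈ Ioo 0 T → ∃ p, RegularSlice a y yx yxx yt t p :=
    (ae_restrict_iff' measurableSet_Ioo).1 hreg
  have hreg'' : ∀ᵐ t ∂(volume : Measure ℝ), t - h ∈ Ioo 0 T →
      ∃ p, RegularSlice a y yx yxx yt (t - h) p :=
    (measurePreserving_sub_right volume h).quasiMeasurePreserving.ae hreg'
  refine integral_mono_ae hlhs hi' ?_
  filter_upwards [ae_restrict_of_ae hreg', ae_restrict_of_ae hreg'',
    ae_restrict_mem measurableSet_Ioo] with t h1 h2 ht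
  have htT : t ∈ Ioo 0 T := ⟨ht.1, ht.2.trans_le hτ⟩
  obtain ⟨p, hp⟩ := h1 htT
  have hzero : y (0, 0) = 0 ∧ y (1, 0) = 0 :=
    ⟨boundary_at_zero hT hy (by simp) fun s hs => (hb s hs).1,
      boundary_at_zero hT hy (by simp) fun s hs => (hb s hs).2⟩
  -- The earlier slice is either a regular one or, when `t - h ≤ 0`, the initial slice, whose
  -- derivative is `w₀`.
  have hprev : ∃ v, ACDeriv (fun x => y (x, max (t - h) 0)) v 0 1 ∧
      MemLp v 2 (volume.restrict I) ∧ y (0, max (t - h) 0) = 0 ∧ y (1, max (t - h) 0) = 0 ∧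
      energy y yx E₀ (t - h) =
        (∫ x in I, y (x, max (t - h) 0) ^ 2) + ∫ x in I, v x ^ 2 := by
    rcases le_or_gt (t - h) 0 with h0 | h0
    · rw [max_eq_right h0]
      exact ⟨w₀, hw₀, hw₀m, hzero.1, hzero.2, by rw [energy, if_pos h0, hE₀]⟩
    · have hth : t - h ∈ Ioo 0 T := ⟨h0, by linarith [htT.2]⟩
      obtain ⟨v, hv⟩ := h2 hth
      rw [max_eq_left h0.le]
      exact ⟨v, hv.acDeriv, hv.memLp, (hb _ hth).1, (hb _ hth).2, hv.energy_eq h0 E₀⟩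
  obtain ⟨v, hv, hvm, hv0, hv1, hve⟩ := hprev
  have key := energy_sub_le hp.acDeriv hp.acDeriv_x hp.memLp_xx hv hvm (hb t htT).1 (hb t htT).2
    hv0 hv1
  rw [← hp.energy_eq ht.1 E₀, ← hve] at key
  have e : ∫ x in I, 2 * Real.exp (2 * ρ * t) * (y (x, t) - yxx (x, t)) *
      ∫ r in (0 : ℝ)..h, (Q T).indicator yt (x, t - r) =
      Real.exp (2 * ρ * t) * (2 * ∫ x in I, (y (x, t) - yxx (x, t)) *
        (y (x, t) - y (x, max (t - h) 0))) := by
    rw [← mul_assoc, ← integral_const_mul]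
    refine integral_congr_ae ?_
    filter_upwards [ae_acDeriv_time hT hy hW, ae_restrict_mem measurableSet_Ioo] with x hx hxm
    rw [← hx.integral_indicator_sub htT hh]
    have : ∀ s, (Q T).indicator yt (x, s) = (Ioo 0 T).indicator (fun s => yt (x, s)) s := by
      intro s
      by_cases hs : s ∈ Ioo 0 T
      · rw [indicator_of_mem hs, indicator_of_mem (show (x, s) ∈ Q T from ⟨hxm, hs⟩)]
      · rw [indicator_of_notMem hs, indicator_of_notMem fun h' => hs h'.2]
    simp only [this]
    ring
  rw [e]
  exact mul_le_mul_of_nonneg_left key (Real.exp_pos _).le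

/-- The averaged bound just before `τ` must be attained, up to ε, at some regular slice in the
averaging window. -/
theorem exists_slice_energy_le (hT : 0 < T) (hy : ContinuousOn y (Icc 0 1 ×ˢ Icc 0 T))
    (hW : IsW212 T y yx yxx yt) (hb : ∀ t ∈ Ioo 0 T, y (0, t) = 0 ∧ y (1, t) = 0)
    (hreg : ∀ᵐ t ∂(volume.restrict (Ioo 0 T)), ∃ p, RegularSlice a y yx yxx yt t p)
    {w₀ : ℝ → ℝ} (hw₀ : ACDeriv (fun x => y (x, 0)) w₀ 0 1) (hw₀m : MemLp w₀ 2 (volume.restrict I))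
    {E₀ : ℝ} (hE₀ : E₀ = (∫ x in I, y (x, 0) ^ 2) + ∫ x in I, w₀ x ^ 2) {ρ : ℝ} (hρ : 0 ≤ ρ)
    (hdiss : ∀ᵐ t ∂(volume.restrict (Ioo 0 T)),
      ∫ x in I, (y (x, t) - yxx (x, t)) * yt (x, t) ≤ -ρ * energy y yx E₀ t)
    {τ : ℝ} (hτ : τ ∈ Ioc 0 T) {ε δ : ℝ} (hε : 0 < ε) (hδ : 0 < δ) :
    ∃ s ∈ Icc 0 T, |s - τ| < δ ∧ ∃ g, HasWeakDeriv I 1 (fun x => y (x, s)) g ∧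
      MemLp g 2 (volume.restrict I) ∧
      (∫ x in I, y (x, s) ^ 2) + ∫ x in I, g x ^ 2 ≤ Real.exp (-(2 * ρ * τ)) * E₀ + ε := by
  have hE₀nn : 0 ≤ E₀ := by
    rw [hE₀]
    exact add_nonneg (integral_nonneg fun x => sq_nonneg _) (integral_nonneg fun x => sq_nonneg _)
  have hw := memLp_weight hW hτ.2 ρ
  have hz : MemLp ((Q T).indicator yt) 2 := (memLp_indicator_iff_restrict (measurableSet_Q T)).2
    hW.memLp_t
  have hEi : IntervalIntegrable (energy y yx E₀) volume 0 τ :=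
    (intervalIntegrable_energy hT hW E₀).mono_set
      (uIcc_subset_uIcc_left (by rw [uIcc_of_le hT.le]; exact Ioc_subset_Icc_self hτ))
  have hexp : Continuous fun t : ℝ => Real.exp (2 * ρ * t) := by fun_prop
  have hkE : IntervalIntegrable (fun t => Real.exp (2 * ρ * t) * energy y yx E₀ t) volume 0 τ :=
    hEi.continuousOn_mul hexp.continuousOn
  have hsub : Ioo 0 τ ⊆ Ioo 0 T := Ioo_subset_Ioo_right hτ.2
  have hΨ0 : ∫ p, (I ×ˢ Ioo 0 τ).indicator
      (fun p => 2 * Real.exp (2 * ρ * p.2) * (y p - yxx p)) p *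
        (Q T).indicator yt (p.1, p.2 - 0) ≤
      -(2 * ρ * ∫ t in (0 : ℝ)..τ, Real.exp (2 * ρ * t) * energy y yx E₀ t) := by
    simp only [sub_zero, Prod.mk.eta]
    obtain ⟨hi, he⟩ := integral_indicator_mul_eq measurableSet_Ioo measurableSet_Ioo
      (integrable_mul_of_memLp_two hw hz)
    rw [he, ← setIntegral_Ioo hτ.1.le, ← neg_mul, ← integral_const_mul]
    refine integral_mono_ae hi (((intervalIntegrable_iff_Ioo hτ.1.le).1 hkE).const_mul _) ?_
    filter_upwards [ae_mono (Measure.restrict_mono hsub le_rfl) hdiss,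
      ae_restrict_mem measurableSet_Ioo] with t h1 ht
    have e : ∫ x in I, 2 * Real.exp (2 * ρ * t) * (y (x, t) - yxx (x, t)) *
        (Q T).indicator yt (x, t) =
        2 * Real.exp (2 * ρ * t) * ∫ x in I, (y (x, t) - yxx (x, t)) * yt (x, t) := by
      rw [← integral_const_mul]
      refine setIntegral_congr_fun measurableSet_Ioo fun x hx => ?_
      rw [indicator_of_mem (show (x, t) ∈ Q T from ⟨hx, hsub ht⟩)]
      ring
    rw [e]
    have := mul_le_mul_of_nonneg_left h1 (Real.exp_pos (2 * ρ * t)).le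
    linarith
  have hev := eventually_integral_le_of_backward_difference hτ.1 hEi (energy_nonneg hE₀nn)
    (fun t ht => if_pos ht) hρ (continuous_integral_mul_timeShift hw hz)
    (fun h hh hhτ => integral_backward_difference_le hT hy hW hb hreg hw₀ hw₀m hE₀ hτ.2 hh hhτ)
    hΨ0 (half_pos hε)
  have hlim : Tendsto (fun h : ℝ => Real.exp (-(2 * ρ * (τ - h))) * (E₀ + ε / 2)) (𝓝[>] 0)
      (𝓝 (Real.exp (-(2 * ρ * (τ - 0))) * (E₀ + ε / 2))) :=
    (Continuous.tendsto (by fun_prop) _).mono_left nhdsWithin_le_nhds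
  have hlt : Real.exp (-(2 * ρ * (τ - 0))) * (E₀ + ε / 2) <
      Real.exp (-(2 * ρ * τ)) * E₀ + ε := by
    have : Real.exp (-(2 * ρ * τ)) ≤ 1 := by
      rw [Real.exp_le_one_iff, neg_nonpos]
      exact mul_nonneg (by positivity) hτ.1.le
    rw [sub_zero]
    nlinarith
  have hmem : ∀ {b : ℝ}, 0 < b → ∀ᶠ h in 𝓝[>] (0 : ℝ), h ∈ Ioo 0 b := fun hb => Ioo_mem_nhdsGT hb
  -- `h` is small enough for the averaged bound, for replacing e^{-2ρτ} by e^{-2ρ(τ-h)} within ε,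
  -- and for `h < τ` and `h < δ`.
  obtain ⟨h, h1, h2, h3, h4⟩ := (hev.and ((hlim.eventually (gt_mem_nhds hlt)).and
    ((hmem hτ.1).and (hmem hδ)))).exists
  have hsub' : Ioo (τ - h) τ ⊆ Ioo 0 T := fun s hs =>
    ⟨by linarith [hs.1, h3.2], hs.2.trans_le hτ.2⟩
  obtain ⟨s, hs, ⟨p, hp⟩, hle⟩ : ∃ s ∈ Ioo (τ - h) τ, (∃ p, RegularSlice a y yx yxx yt s p) ∧
      Real.exp (2 * ρ * s) * energy y yx E₀ s ≤ E₀ + ε / 2 := by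
    -- Regular slices have full measure, so failure at all of them would push the average over (τ-h,
    -- τ) above E₀ + ε/2.
    by_contra! hcon
    have hlt' : ∀ᵐ s ∂(volume.restrict (Ioo (τ - h) τ)),
        E₀ + ε / 2 < Real.exp (2 * ρ * s) * energy y yx E₀ s := by
      filter_upwards [ae_mono (Measure.restrict_mono hsub' le_rfl) hreg,
        ae_restrict_mem measurableSet_Ioo] with s hs hsm
      exact hcon s hsm hs
    have hi : IntegrableOn (fun s => Real.exp (2 * ρ * s) * energy y yx E₀ s) (Ioo (τ - h) τ) :=
      ((intervalIntegrable_iff_Ioo hτ.1.le).1 hkE).mono_set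
        (Ioo_subset_Ioo_left (by linarith [h3.2]))
    rw [← setIntegral_Ioo (by linarith [h3.1])] at h1
    have hpos : 0 < ∫ s in Ioo (τ - h) τ,
        (Real.exp (2 * ρ * s) * energy y yx E₀ s - (E₀ + ε / 2)) := by
      rw [integral_pos_iff_support_of_nonneg_ae]
      · have hsupp : ∀ᵐ s ∂(volume.restrict (Ioo (τ - h) τ)), s ∈ Function.support
            fun s => Real.exp (2 * ρ * s) * energy y yx E₀ s - (E₀ + ε / 2) := by
          filter_upwards [hlt'] with s hs using (sub_pos.2 hs).ne'
        rw [measure_eq_measure_of_null_sdiff (subset_univ _) (by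
          rw [← compl_eq_univ_sdiff]; exact hsupp)]
        simp [h3.1]
      · filter_upwards [hlt'] with s hs using (sub_pos.2 hs).le
      · exact Integrable.sub hi (integrable_const _)
    rw [integral_sub hi (integrable_const _)] at hpos
    simp only [integral_const, measureReal_restrict_apply_univ, Real.volume_real_Ioo, smul_eq_mul,
      sub_sub_cancel, max_eq_left h3.1.le] at hpos
    linarith
  refine ⟨s, Ioo_subset_Icc_self (hsub' hs), ?_, p, hp.acDeriv.hasWeakDeriv zero_le_one,
    hp.memLp, ?_⟩
  · rw [abs_lt]; exact ⟨by linarith [hs.1, h4.2], by linarith [hs.2]⟩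
  · rw [← hp.energy_eq (hsub' hs).1 E₀]
    calc energy y yx E₀ s
        = Real.exp (-(2 * ρ * s)) * (Real.exp (2 * ρ * s) * energy y yx E₀ s) := by
          rw [← mul_assoc, ← Real.exp_add]; simp
      _ ≤ Real.exp (-(2 * ρ * s)) * (E₀ + ε / 2) := by gcongr
      _ ≤ Real.exp (-(2 * ρ * (τ - h))) * (E₀ + ε / 2) := by
          gcongr
          exact hs.1.le
      _ ≤ _ := h2.le

end Decay

theorem IsSolution.exists_hasWeakDeriv_and_energy_le {C₀ : ℝ} (hGN : IsGagliardoNirenbergConst C₀)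
    {a : ℝ → ℝ} {M ρ κ : ℝ} (ha : ContDiff ℝ 1 a) (hM : 0 < M) (haM : ∀ s, |deriv a s| ≤ M)
    (hρ : 0 < ρ) (haρ : ∀ s, ρ ≤ a s) (haκ : ∀ s, a s ≤ κ) {T : ℝ} (hT : 0 < T) {y₀ : ℝ → ℝ}
    {y : ℝ × ℝ → ℝ} (hy₀ : MemH1 y₀) (hsol : IsSolution a T y₀ y)
    (hsmall : ∀ t ∈ Ioo 0 T, eLpNorm (fun x => y (x, t)) ∞ (volume.restrict I) ≤
      ENNReal.ofReal (ρ / (4 * M * C₀ ^ 2))) {t : ℝ} (ht : t ∈ Icc 0 T) :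
    ∃ g, HasWeakDeriv I 1 (fun x => y (x, t)) g ∧ MemLp g 2 (volume.restrict I) ∧
      (∫ x in I, y (x, t) ^ 2) + ∫ x in I, g x ^ 2 ≤ Real.exp (-(2 * ρ * t)) * h1Norm y₀ ^ 2 := by
  obtain ⟨hy, ⟨yx, yxx, yt, hW, hflux⟩, hb, hinit⟩ := hsol
  obtain ⟨-, w₀, hw₀, hw₀m⟩ := hy₀
  have h0 : HasWeakDeriv I 1 (fun x => y (x, 0)) w₀ :=
    hw₀.congr (EventuallyEq.symm hinit) (ae_eq_refl _)
  have hE₀ : h1Norm y₀ ^ 2 = (∫ x in I, y (x, 0) ^ 2) + ∫ x in I, w₀ x ^ 2 := by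
    have e : ∫ x in I, y (x, 0) ^ 2 = ∫ x in I, y₀ x ^ 2 := by
      refine integral_congr_ae ?_
      filter_upwards [hinit] with x hx
      rw [hx]
    rw [h1Norm_eq hw₀, e, Real.sq_sqrt]
    exact add_nonneg (integral_nonneg fun x => sq_nonneg _) (integral_nonneg fun x => sq_nonneg _)
  -- Averaging before `t` needs `t > 0`; at `t = 0` the initial condition gives equality.
  rcases eq_or_lt_of_le ht.1 with rfl | ht0
  · exact ⟨w₀, h0, hw₀m, by simp [hE₀]⟩
  have h0' : ACDeriv (fun x => y (x, 0)) w₀ 0 1 := ACDeriv.of_hasWeakDeriv one_pos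
    (ContinuousOn.slice_left hy (left_mem_Icc.2 hT.le)) h0 (hw₀m.integrable (by norm_num))
  have hreg := ae_regularSlice hy hW hflux ha.continuous (K := κ) fun s => by
    rw [Real.norm_of_nonneg (hρ.le.trans (haρ s))]; exact haκ s
  have hdiss : ∀ᵐ t ∂(volume.restrict (Ioo 0 T)),
      ∫ x in I, (y (x, t) - yxx (x, t)) * yt (x, t) ≤ -ρ * energy y yx (h1Norm y₀ ^ 2) t := by
    filter_upwards [hreg, ae_restrict_mem measurableSet_Ioo] with s ⟨p, hp⟩ hs
    rw [hp.energy_eq hs.1]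
    exact integral_sub_mul_flux_deriv_le hGN ha hM haM hρ haρ hp.acDeriv hp.acDeriv_x hp.memLp_xx
      (hb s hs).1 (hb s hs).2 (hsmall s hs) hp.flux
  exact exists_hasWeakDeriv_slice hy ht fun ε hε δ hδ =>
    exists_slice_energy_le hT hy hW hb hreg h0' hw₀m hE₀ hρ.le hdiss ⟨ht0, ht.2⟩ hε hδ

end QuasilinearDecay

/-! ### The decay theorem -/

theorem proposition2p2 :
    (∃ C₀ : ℝ, QuasilinearDecay.IsGagliardoNirenbergConst C₀) ∧
    ∀ C₀ : ℝ, QuasilinearDecay.IsGagliardoNirenbergConst C₀ →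
    ∀ (a : ℝ → ℝ) (M ρ κ : ℝ), ContDiff ℝ 2 a →
      0 < M → (∀ s, |deriv a s| ≤ M) → (∀ s, |deriv (deriv a) s| ≤ M) →
      0 < ρ → (∀ s, ρ ≤ a s) → (∀ s, a s ≤ κ) →
    ∀ T : ℝ, 0 < T →
    ∀ (y₀ : ℝ → ℝ) (y : ℝ × ℝ → ℝ), QuasilinearDecay.MemH1Zero y₀ →
      QuasilinearDecay.IsSolution a T y₀ y →
      (∀ t ∈ Set.Ioo 0 T,
        MeasureTheory.eLpNorm (fun x => y (x, t)) ⊤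
            (MeasureTheory.volume.restrict (Set.Ioo (0 : ℝ) 1)) ≤
          ENNReal.ofReal (ρ / (4 * M * C₀ ^ 2))) →
      ∀ t ∈ Set.Icc 0 T,
        QuasilinearDecay.MemH1 (fun x => y (x, t)) ∧
        QuasilinearDecay.h1Norm (fun x => y (x, t)) ≤
          Real.exp (-((2 * Real.pi ^ 2 - 1) * ρ * t / (2 * (Real.pi ^ 2 + 1)))) *
            QuasilinearDecay.h1Norm y₀ := by
  refine ⟨QuasilinearDecay.exists_gagliardoNirenbergConst, ?_⟩
  intro C₀ hGN a M ρ κ ha hM haM _ hρ haρ haκ T hT y₀ y hy₀ hsol hsmall t ht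
  obtain ⟨g, hg, hgm, hle⟩ := hsol.exists_hasWeakDeriv_and_energy_le hGN
    (ha.of_le one_le_two) hM haM hρ haρ haκ hT hy₀.1 hsmall ht
  refine ⟨⟨QuasilinearDecay.ContinuousOn.memLp_Ioo
    (QuasilinearDecay.ContinuousOn.slice_left hsol.continuousOn ht) 2, g, hg, hgm⟩, ?_⟩
  have hn : 0 ≤ QuasilinearDecay.h1Norm y₀ := Real.sqrt_nonneg _
  -- The proved rate is ρ; the stated one is smaller because 2π² - 1 ≤ 2(π² + 1).
  have hrate : (2 * Real.pi ^ 2 - 1) * ρ * t / (2 * (Real.pi ^ 2 + 1)) ≤ ρ * t := by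
    have h0 : 0 ≤ ρ * t := mul_nonneg hρ.le ht.1
    rw [div_le_iff₀ (by positivity)]
    nlinarith
  rw [QuasilinearDecay.h1Norm_eq hg]
  calc _ ≤ Real.exp (-(ρ * t)) * QuasilinearDecay.h1Norm y₀ := by
        refine Real.sqrt_le_iff.2 ⟨by positivity, hle.trans (le_of_eq ?_)⟩
        rw [mul_pow, ← Real.exp_nat_mul]
        congr 2
        push_cast
        ring
    _ ≤ _ := by gcongr
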